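/- A temporal graph $\mathcal G=(G_1,\dots,G_T)$ is a sequence of $T$ simple graphs (snapshots) $G_i=(V,E_i)$ on a common finite vertex set $V$; put $n=|V|$. A temporal edge is a pair $(e,i)$ with $e\in E_i$. For $1\le i\le T$ let $$F_i=\{v\in V:\ \exists\, p\le i\le q \text{ in } \{1,\dots,T\}\text{ with } \deg_{G_p}(v)\ge 1 \text{ and } \deg_{G_q}(v)\ge 1\},$$ and let $\mathrm{vimw}(\mathcal G)=\max_{i}|F_i|$ be the vertex-interval-membership-width ($0$ if $T=0$). A $k$-activity $\ell$-timeline is a set $\mathcal T$ of triples $(v,a,b)\in V\times\{1,\dots,T\}^2$ with $a\le b$ and $b-a\le \ell$ that contains, for each vertex $v$, at most $k$ triples with first entry $v$. It covers the temporal edge $(e,i)$ if there are an endpoint $v$ of $e$ and a triple $(v,a,b)\in\mathcal T$ with $a\le i\le b$. Timeline Partial Vertex Cover (Timeline PVC): given $\mathcal G$ and integers $k\ge 1$, $\ell\ge 0$, $t\ge 0$, is there a $k$-activity $\ell$-timeline that covers at least $t$ temporal edges? Timeline Vertex Cover (Timeline VC): given $\mathcal G$, $k\ge1$, $\ell\ge0$,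 is there a $k$-activity $\ell$-timeline that covers all temporal edges? Instances are given by the numbers $n,T,k,\ell$ (and $t$) and the adjacency matrices of the snapshots. Time is the number of steps of a word RAM (unit-cost arithmetic, comparison and indirect memory access on words), where a time bound $\tau$ comes with words of $O(\log(\tau+N))$ bits, $N$ being the sum of the number of input words and the largest input number. The length $|I|$ of an instance $I$ is the length of its input with all numbers written in binary. **Theorem.** Each of Timeline PVC and Timeline VC is solvable 1. in $\big((k+1)(\ell+2)\big)^{2\,\mathrm{vimw}(\mathcal G)}\cdot (n+T+2)^{O(1)}$ time; 2. in $f(\mathrm{vimw}(\mathcal G)+k+\ell)\cdot|I|^{O(1)}$ time for some computable $f$, that is, the problem is fixed-parameter tractable with respect to $\mathrm{vimw}+k+\ell$; 3. in $f(\mathrm{vimw}(\mathcal G))\cdot|I|^{g(\mathrm{vimw}(\mathcal G))}$ time for some computable $f$ and $g$, that is, the problem is slice-wise polynomial (XP) with respect to $\mathrm{vimw}$. -/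

import Mathlib

/-! ## Word RAM programs and their running time -/

namespace WordRAM

/-- The unit-cost arithmetic operations on machine words.  Subtraction is truncated at `0`,
division rounds down, and division by `0` gives `0`. -/
inductive Op
  | add
  | sub
  | mul
  | div

/-- The value of an arithmetic operation. -/
def Op.eval : Op → ℕ → ℕ → ℕ
  | .add, a, b => a + b
  | .sub, a, b => a - b
  | .mul, a, b => a * b
  | .div, a, b => a / b

/-- Programs of the random access machine.  A program names finitely many registers directly;
the memory is reached only by indirect addressing. -/
inductive Prog
  /-- do nothing -/
  | skip
  /-- `reg x := c` -/
  | const (x c : ℕ)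
  /-- `reg x := reg y` -/
  | copy (x y : ℕ)
  /-- `reg x := reg y ∘ reg z` -/
  | arith (o : Op) (x y z : ℕ)
  /-- `reg x := mem (reg y)` -/
  | load (x y : ℕ)
  /-- `mem (reg x) := reg y` -/
  | store (x y : ℕ)
  /-- run `p`, then `q` -/
  | seq (p q : Prog)
  /-- if `reg x ≤ reg y` then run `p`, else run `q` -/
  | ite (x y : ℕ) (p q : Prog)
  /-- as long as `reg x < reg y`, run `p` -/
  | loop (x y : ℕ) (p : Prog)

/-- A machine state: the contents of the registers and of the memory cells. -/
@[ext]
structure Store where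
  reg : ℕ → ℕ
  mem : ℕ → ℕ

/-- Overwrite a register. -/
def Store.setReg (s : Store) (x v : ℕ) : Store where
  reg := Function.update s.reg x v
  mem := s.mem

/-- Overwrite a memory cell. -/
def Store.setMem (s : Store) (a v : ℕ) : Store where
  reg := s.reg
  mem := Function.update s.mem a v

/-- `Exec W p s m s'`: started in `s`, the program `p` halts in `s'` after exactly `m` steps, on a
machine whose words hold the numbers `0, …, W`.  Every elementary instruction and every test is
one step.  An instruction whose result does not fit in a word has no successor state, so a
program that overflows does not halt in this sense. -/
inductive Exec (W : ℕ) : Prog → Store → ℕ → Store → Prop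
  | skip (s : Store) : Exec W .skip s 1 s
  | const (s : Store) (x c : ℕ) (h : c ≤ W) : Exec W (.const x c) s 1 (s.setReg x c)
  | copy (s : Store) (x y : ℕ) (h : s.reg y ≤ W) :
      Exec W (.copy x y) s 1 (s.setReg x (s.reg y))
  | arith (s : Store) (o : Op) (x y z : ℕ) (h : o.eval (s.reg y) (s.reg z) ≤ W) :
      Exec W (.arith o x y z) s 1 (s.setReg x (o.eval (s.reg y) (s.reg z)))
  | load (s : Store) (x y : ℕ) (h : s.mem (s.reg y) ≤ W) :
      Exec W (.load x y) s 1 (s.setReg x (s.mem (s.reg y)))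
  | store (s : Store) (x y : ℕ) (h : s.reg y ≤ W) :
      Exec W (.store x y) s 1 (s.setMem (s.reg x) (s.reg y))
  | seq {p q : Prog} {s s₁ s₂ : Store} {m₁ m₂ : ℕ} (h₁ : Exec W p s m₁ s₁)
      (h₂ : Exec W q s₁ m₂ s₂) : Exec W (.seq p q) s (m₁ + m₂) s₂
  | ite_true {x y : ℕ} {p q : Prog} {s s₁ : Store} {m : ℕ} (h : s.reg x ≤ s.reg y)
      (h₁ : Exec W p s m s₁) : Exec W (.ite x y p q) s (m + 1) s₁
  | ite_false {x y : ℕ} {p q : Prog} {s s₁ : Store} {m : ℕ} (h : ¬ s.reg x ≤ s.reg y)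
      (h₁ : Exec W q s m s₁) : Exec W (.ite x y p q) s (m + 1) s₁
  | loop_done {x y : ℕ} {p : Prog} {s : Store} (h : ¬ s.reg x < s.reg y) :
      Exec W (.loop x y p) s 1 s
  | loop_step {x y : ℕ} {p : Prog} {s s₁ s₂ : Store} {m₁ m₂ : ℕ} (h : s.reg x < s.reg y)
      (h₁ : Exec W p s m₁ s₁) (h₂ : Exec W (.loop x y p) s₁ m₂ s₂) :
      Exec W (.loop x y p) s (m₁ + 1 + m₂) s₂

/-- The initial state on an input, which is a list of words: the input occupies the memory cells
`0, 1, …`, and all other memory cells and all registers are `0`. -/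
def initStore (input : List ℕ) : Store where
  reg := fun _ => 0
  mem := fun a => input.getD a 0

/-- The length of an input as a string: every number is written in binary, followed by a
delimiter. -/
def inputLength (input : List ℕ) : ℕ :=
  (input.map fun w => Nat.size w + 1).sum

open Classical in
/-- The problem `L` on instances `α`, presented to the machine through `enc`, is solvable in
`O(τ)` time: one fixed program answers every instance `x` correctly (by `1` or `0` in register
`0`) within `c * τ x` steps, on words of `O(log (τ x + number of input words + largest input
number))` bits. -/
def SolvableInTime {α : Type*} (enc : α → List ℕ) (L : α → Prop) (τ : α → ℕ) : Prop :=
  ∃ (p : Prog) (c : ℕ), ∀ x : α, ∃ (m : ℕ) (s : Store),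
    Exec ((τ x + (enc x).length + (enc x).foldr max 0 + 2) ^ c) p (initStore (enc x)) m s ∧
    m ≤ c * τ x ∧
    s.reg 0 = if L x then 1 else 0

/-- `L` is fixed-parameter tractable with respect to the parameter `κ`: it is solvable in
`f (κ x) * |x| ^ O(1)` time for a computable function `f`. -/
def IsFPT {α : Type*} (enc : α → List ℕ) (L : α → Prop) (κ : α → ℕ) : Prop :=
  ∃ f : ℕ → ℕ, Computable f ∧ ∃ c : ℕ,
    SolvableInTime enc L fun x => f (κ x) * inputLength (enc x) ^ c

/-- `L` is slice-wise polynomial with respect to the parameter `κ`: it is solvable in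
`f (κ x) * |x| ^ g (κ x)` time for computable functions `f` and `g`. -/
def IsXP {α : Type*} (enc : α → List ℕ) (L : α → Prop) (κ : α → ℕ) : Prop :=
  ∃ f g : ℕ → ℕ, Computable f ∧ Computable g ∧
    SolvableInTime enc L fun x => f (κ x) * inputLength (enc x) ^ g (κ x)

end WordRAM

/-! ## Temporal graphs and timelines -/

/-- A temporal graph on the vertex set `V` with lifetime `T`: a sequence of `T` snapshots.  The
time steps are `0, …, T - 1`. -/
def TemporalGraph (V : Type*) (T : ℕ) : Type _ := Fin T → SimpleGraph V

namespace TemporalGraph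

variable {V : Type*} {T : ℕ}

/-- The degree of `v` in the snapshot at time `i`. -/
noncomputable def deg (G : TemporalGraph V T) (i : Fin T) (v : V) : ℕ :=
  ((G i).neighborSet v).ncard

/-- The bag of time step `i` in the vertex-interval-membership sequence. -/
def bag (G : TemporalGraph V T) (i : Fin T) : Set V :=
  {v | ∃ p q : Fin T, p ≤ i ∧ i ≤ q ∧ 1 ≤ G.deg p v ∧ 1 ≤ G.deg q v}

/-- The vertex-interval-membership-width: the maximum size of a bag. -/
noncomputable def vimw (G : TemporalGraph V T) : ℕ :=
  Finset.univ.sup fun i : Fin T => (G.bag i).ncard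

/-- The temporal edges `(e, i)`, where `e` is an edge of the snapshot at time `i`. -/
def temporalEdges (G : TemporalGraph V T) : Set (Sym2 V × Fin T) :=
  {e | e.1 ∈ (G e.2).edgeSet}

end TemporalGraph

/-- A set `S` of triples `(v, a, b)` is a `k`-activity `ℓ`-timeline: each triple is an activity
interval `a ≤ b` of length `b - a ≤ ℓ`, and every vertex has at most `k` activity intervals. -/
def IsTimeline {V : Type*} {T : ℕ} (k ℓ : ℕ) (S : Set (V × Fin T × Fin T)) : Prop :=
  (∀ x ∈ S, x.2.1 ≤ x.2.2 ∧ (x.2.2 : ℕ) - (x.2.1 : ℕ) ≤ ℓ) ∧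
  ∀ v : V, {x ∈ S | x.1 = v}.ncard ≤ k

/-- The vertex `v` is active at time `i`. -/
def IsActive {V : Type*} {T : ℕ} (S : Set (V × Fin T × Fin T)) (v : V) (i : Fin T) : Prop :=
  ∃ a b : Fin T, (v, a, b) ∈ S ∧ a ≤ i ∧ i ≤ b

/-- The temporal edge `e` is covered: one of its endpoints is active at its time. -/
def IsCovered {V : Type*} {T : ℕ} (S : Set (V × Fin T × Fin T)) (e : Sym2 V × Fin T) : Prop :=
  ∃ v ∈ e.1, IsActive S v e.2

/-! ## The two problems -/

/-- An instance of Timeline Vertex Cover.  The vertices are `0, …, n - 1`. -/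
structure TVCInstance where
  n : ℕ
  T : ℕ
  G : TemporalGraph (Fin n) T
  k : ℕ
  ℓ : ℕ
  one_le_k : 1 ≤ k

/-- An instance of Timeline Partial Vertex Cover. -/
structure TPVCInstance extends TVCInstance where
  t : ℕ

/-- Timeline Vertex Cover: some `k`-activity `ℓ`-timeline covers all temporal edges. -/
def TimelineVC (I : TVCInstance) : Prop :=
  ∃ S : Set (Fin I.n × Fin I.T × Fin I.T), IsTimeline I.k I.ℓ S ∧
    ∀ e ∈ I.G.temporalEdges, IsCovered S e

/-- Timeline Partial Vertex Cover: some `k`-activity `ℓ`-timeline covers at least `t` temporal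
edges. -/
def TimelinePVC (I : TPVCInstance) : Prop :=
  ∃ S : Set (Fin I.n × Fin I.T × Fin I.T), IsTimeline I.k I.ℓ S ∧
    I.t ≤ {e ∈ I.G.temporalEdges | IsCovered S e}.ncard

open Classical in
/-- The adjacency matrices of the snapshots, one after the other, each row by row. -/
noncomputable def TemporalGraph.encode {n T : ℕ} (G : TemporalGraph (Fin n) T) : List ℕ :=
  (List.finRange T).flatMap fun i => (List.finRange n).flatMap fun u =>
    (List.finRange n).map fun v => if (G i).Adj u v then 1 else 0

/-- The input words of an instance of Timeline Vertex Cover. -/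
noncomputable def TVCInstance.encode (I : TVCInstance) : List ℕ :=
  [I.n, I.T, I.k, I.ℓ] ++ I.G.encode

/-- The input words of an instance of Timeline Partial Vertex Cover. -/
noncomputable def TPVCInstance.encode (I : TPVCInstance) : List ℕ :=
  [I.n, I.T, I.k, I.ℓ, I.t] ++ I.G.encode

/-! The algorithm is a dynamic program over the bags. A vertex has edges only at times when it lies
in the bag, and these times form one interval (`Bag.between`). Its history is therefore irrelevant
before it enters and after it leaves.

Inside the bags the history of a vertex is a single digit `d ≤ k * L` with `L = ℓ + 2`. The quotient
`d / L` is the number of activity intervals already used up. The residue is `0` for inactivity, and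
`1, …, ℓ + 1` for the position in the current interval. A transition only demands that a digit does
not decrease, and that it grows by at least one if the vertex was active. Jumping further merely
wastes budget.

Such a sequence of digits is a `Run`. In a run the active times with a common quotient span at most
`ℓ`, and there are only `k` quotients, so a run yields a timeline (`Run.growth`,
`exists_timeline_of_run`). Conversely, a timeline yields a run: the digit moves to the next multiple
of `L` plus one whenever an interval starts, and otherwise it advances minimally
(`exists_run_of_timeline`).

A table entry is a number `x`, made of the digits of the bag written as a mixed radix code `x / E`
and a number `x % E` of covered edges. Vertices outside the bag have base `1`, so there are at most
`P ≤ S ^ vimw` codes, with `S = k * L + 1` (`P_dp_le`). All pairs of entries in consecutive layers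
are tested, which costs `P ^ 2` times a polynomial in `n + T`. Timeline VC is the case in which the
threshold is the number of all temporal edges, which the program counts.

The numbers `k` and `ℓ` can be capped at `T` without loss. Thus `S` is bounded by `(k + 1) * (ℓ +
2)`, which gives the first two running times, and also by `(n + T + 2) ^ 2`, which gives the third.
If `T * n * n = 0` there are no edges, but `n` or `T` may be exponential in the length of the input,
so the program stops early.

To reach the word RAM, the program is written in a language with counted loops. `Cmd.exec_compile`
transfers its result, its overflow conditions and its cost to the machine, and `Cmd.Spec` is the
calculus for verifying it. -/

/-! ## A structured language with bounded loops and its compilation to the word RAM -/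

namespace WordRAM

/-- Expressions over the variables `V` and the memory. -/
inductive Expr (V : Type)
  | const (c : ℕ)
  | var (x : V)
  | mem (e : Expr V)
  | bin (o : Op) (a b : Expr V)
  | mod (a b : Expr V)

/-- Commands.  The loop `forLoop i n c` runs `c` for `i = 0, …, n - 1`. -/
inductive Cmd (V : Type)
  | skip
  | assign (x : V) (e : Expr V)
  | store (a e : Expr V)
  | seq (p q : Cmd V)
  | ite (a b : Expr V) (p q : Cmd V)
  | forLoop (i n : V) (c : Cmd V)

/-- The state of a structured program. -/
structure State (V : Type) where
  reg : V → ℕ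
  mem : ℕ → ℕ

/-! ### States of structured programs. -/

namespace State

variable {V : Type}

/-- Overwrite a memory cell. -/
def setMem (σ : State V) (a v : ℕ) : State V where
  reg := σ.reg
  mem := Function.update σ.mem a v

@[simp] theorem setMem_reg (σ : State V) (a v : ℕ) : (σ.setMem a v).reg = σ.reg := rfl

@[simp] theorem setMem_mem_self (σ : State V) (a v : ℕ) : (σ.setMem a v).mem a = v := by
  simp [setMem]

theorem setMem_mem_of_ne (σ : State V) {a b : ℕ} (v : ℕ) (h : b ≠ a) :
    (σ.setMem a v).mem b = σ.mem b := by
  simp [setMem, h]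

/-- All variables and memory cells fit into words with the numbers `0, …, W`. -/
def Fits (W : ℕ) (σ : State V) : Prop :=
  (∀ x, σ.reg x ≤ W) ∧ ∀ a, σ.mem a ≤ W

theorem Fits.setMem {W : ℕ} {σ : State V} (h : σ.Fits W) (a : ℕ) {v : ℕ} (hv : v ≤ W) :
    (σ.setMem a v).Fits W := by
  refine ⟨h.1, fun b => ?_⟩
  by_cases hb : b = a
  · rwa [hb, setMem_mem_self]
  · rw [setMem_mem_of_ne _ _ hb]; exact h.2 b

variable [DecidableEq V]

/-- Overwrite a variable. -/
def setReg (σ : State V) (x : V) (v : ℕ) : State V where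
  reg := Function.update σ.reg x v
  mem := σ.mem

@[simp] theorem setReg_mem (σ : State V) (x : V) (v : ℕ) : (σ.setReg x v).mem = σ.mem := rfl

@[simp] theorem setReg_reg_self (σ : State V) (x : V) (v : ℕ) : (σ.setReg x v).reg x = v := by
  simp [setReg]

@[simp] theorem setReg_reg_of_ne (σ : State V) {x y : V} (v : ℕ) (h : y ≠ x) :
    (σ.setReg x v).reg y = σ.reg y := by
  simp [setReg, h]

theorem Fits.setReg {W : ℕ} {σ : State V} (h : σ.Fits W) (x : V) {v : ℕ} (hv : v ≤ W) :
    (σ.setReg x v).Fits W := by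
  refine ⟨fun y => ?_, h.2⟩
  by_cases hy : y = x
  · subst hy; simpa using hv
  · simpa [hy] using h.1 y

end State

/-! ### Expressions: values, absence of overflow, cost and code. -/

namespace Expr

variable {V : Type}

instance : Add (Expr V) := ⟨.bin .add⟩
instance : Sub (Expr V) := ⟨.bin .sub⟩
instance : Mul (Expr V) := ⟨.bin .mul⟩
instance : Div (Expr V) := ⟨.bin .div⟩
instance : Mod (Expr V) := ⟨.mod⟩
instance (c : ℕ) : OfNat (Expr V) c := ⟨.const c⟩

/-- The value of an expression. -/
def eval (σ : State V) : Expr V → ℕ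
  | .const c => c
  | .var x => σ.reg x
  | .mem e => σ.mem (e.eval σ)
  | .bin o a b => o.eval (a.eval σ) (b.eval σ)
  | .mod a b => a.eval σ % b.eval σ

/-- The evaluation of an expression does not overflow. -/
def Ok (W : ℕ) (σ : State V) : Expr V → Prop
  | .const c => c ≤ W
  | .var _ => True
  | .mem e => e.Ok W σ
  | .bin .add a b => a.Ok W σ ∧ b.Ok W σ ∧ a.eval σ + b.eval σ ≤ W
  | .bin .mul a b => a.Ok W σ ∧ b.Ok W σ ∧ a.eval σ * b.eval σ ≤ W
  | .bin .sub a b => a.Ok W σ ∧ b.Ok W σ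
  | .bin .div a b => a.Ok W σ ∧ b.Ok W σ
  | .mod a b => a.Ok W σ ∧ b.Ok W σ

section simp

variable (W : ℕ) (σ : State V) (a b : Expr V) (c : ℕ) (x : V)

@[simp] theorem eval_ofNat : (ofNat(c) : Expr V).eval σ = c := rfl
@[simp] theorem eval_const : (const c : Expr V).eval σ = c := rfl
@[simp] theorem eval_var : (var x).eval σ = σ.reg x := rfl
@[simp] theorem eval_mem : (mem a).eval σ = σ.mem (a.eval σ) := rfl
@[simp] theorem eval_add : (a + b).eval σ = a.eval σ + b.eval σ := rfl
@[simp] theorem eval_sub : (a - b).eval σ = a.eval σ - b.eval σ := rfl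
@[simp] theorem eval_mul : (a * b).eval σ = a.eval σ * b.eval σ := rfl
@[simp] theorem eval_div : (a / b).eval σ = a.eval σ / b.eval σ := rfl
@[simp] theorem eval_mod : (a % b).eval σ = a.eval σ % b.eval σ := rfl
@[simp] theorem ok_ofNat : (ofNat(c) : Expr V).Ok W σ ↔ c ≤ W := Iff.rfl
@[simp] theorem ok_const : (const c : Expr V).Ok W σ ↔ c ≤ W := Iff.rfl
@[simp] theorem ok_var : (var x).Ok W σ ↔ True := Iff.rfl
@[simp] theorem ok_mem : (mem a).Ok W σ ↔ a.Ok W σ := Iff.rfl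
@[simp] theorem ok_add :
    (a + b).Ok W σ ↔ a.Ok W σ ∧ b.Ok W σ ∧ a.eval σ + b.eval σ ≤ W := Iff.rfl
@[simp] theorem ok_mul :
    (a * b).Ok W σ ↔ a.Ok W σ ∧ b.Ok W σ ∧ a.eval σ * b.eval σ ≤ W := Iff.rfl
@[simp] theorem ok_sub : (a - b).Ok W σ ↔ a.Ok W σ ∧ b.Ok W σ := Iff.rfl
@[simp] theorem ok_div : (a / b).Ok W σ ↔ a.Ok W σ ∧ b.Ok W σ := Iff.rfl
@[simp] theorem ok_mod : (a % b).Ok W σ ↔ a.Ok W σ ∧ b.Ok W σ := Iff.rfl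

end simp

/-- Truncated subtraction, division and remainder never exceed their first argument, so `Ok` needs
explicit bounds only for constants, sums and products. -/
theorem Ok.eval_le {W : ℕ} {σ : State V} (hσ : σ.Fits W) :
    ∀ {e : Expr V}, e.Ok W σ → e.eval σ ≤ W
  | .const _, h => h
  | .var x, _ => hσ.1 x
  | .mem _, _ => hσ.2 _
  | .bin .add _ _, h => h.2.2
  | .bin .mul _ _, h => h.2.2
  | .bin .sub _ _, h => (Nat.sub_le _ _).trans (Ok.eval_le hσ h.1)
  | .bin .div _ _, h => (Nat.div_le_self _ _).trans (Ok.eval_le hσ h.1)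
  | .mod _ _, h => (Nat.mod_le _ _).trans (Ok.eval_le hσ h.1)

/-- The number of steps that the evaluation of an expression takes. -/
def cost : Expr V → ℕ
  | .const _ => 1
  | .var _ => 1
  | .mem e => e.cost + 1
  | .bin _ a b => a.cost + b.cost + 1
  | .mod a b => a.cost + b.cost + 3

section simp

variable (a b : Expr V) (c : ℕ) (x : V)

@[simp] theorem cost_ofNat : (ofNat(c) : Expr V).cost = 1 := rfl
@[simp] theorem cost_const : (const c : Expr V).cost = 1 := rfl
@[simp] theorem cost_var : (var x).cost = 1 := rfl
@[simp] theorem cost_mem : (mem a).cost = a.cost + 1 := rfl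
@[simp] theorem cost_add : (a + b).cost = a.cost + b.cost + 1 := rfl
@[simp] theorem cost_sub : (a - b).cost = a.cost + b.cost + 1 := rfl
@[simp] theorem cost_mul : (a * b).cost = a.cost + b.cost + 1 := rfl
@[simp] theorem cost_div : (a / b).cost = a.cost + b.cost + 1 := rfl
@[simp] theorem cost_mod : (a % b).cost = a.cost + b.cost + 3 := rfl

end simp

/-- The code that evaluates an expression into register `2 * r + 1`.  The variable `x` lives in
register `2 * idx x`, and the odd registers below `2 * r + 1` are left alone. -/
def compile (idx : V → ℕ) : ℕ → Expr V → Prog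
  | r, .const c => .const (2 * r + 1) c
  | r, .var x => .copy (2 * r + 1) (2 * idx x)
  | r, .mem e => .seq (e.compile idx r) (.load (2 * r + 1) (2 * r + 1))
  | r, .bin o a b => .seq (a.compile idx r) (.seq (b.compile idx (r + 1))
      (.arith o (2 * r + 1) (2 * r + 1) (2 * r + 3)))
  | r, .mod a b => .seq (a.compile idx r) (.seq (b.compile idx (r + 1))
      (.seq (.arith .div (2 * r + 5) (2 * r + 1) (2 * r + 3))
        (.seq (.arith .mul (2 * r + 5) (2 * r + 5) (2 * r + 3))
          (.arith .sub (2 * r + 1) (2 * r + 1) (2 * r + 5)))))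

end Expr

/-- The machine state `s` represents the state `σ`. -/
def Store.Represents {V : Type} (idx : V → ℕ) (s : Store) (σ : State V) : Prop :=
  (∀ x, s.reg (2 * idx x) = σ.reg x) ∧ s.mem = σ.mem


theorem Store.setReg_reg (s : Store) (x v y : ℕ) :
    (s.setReg x v).reg y = if y = x then v else s.reg y := by
  simp [Store.setReg, Function.update_apply]

theorem Exec.of_eq {W : ℕ} {p : Prog} {s s' : Store} {m m' : ℕ} (h : Exec W p s m s')
    (e : m = m') : Exec W p s m' s' :=
  e ▸ h

theorem Store.Represents.congr {V : Type} {idx : V → ℕ} {s s' : Store} {σ : State V}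
    (h : s.Represents idx σ) (hm : s'.mem = s.mem) (hr : ∀ x, s'.reg (2 * x) = s.reg (2 * x)) :
    s'.Represents idx σ :=
  ⟨fun x => (hr _).trans (h.1 x), hm.trans h.2⟩

theorem Store.Represents.setOdd {V : Type} {idx : V → ℕ} {s : Store}
    {σ : State V} (h : s.Represents idx σ) (r v : ℕ) :
    (s.setReg (2 * r + 1) v).Represents idx σ :=
  h.congr rfl fun x => by rw [Store.setReg_reg, if_neg (by omega)]

/-- The odd registers form an evaluation stack and the even ones hold the variables. The last
conjunct is what protects the first operand, stored at height `r`, while the second is evaluated at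
height `r + 1`. -/
theorem Expr.exec_compile {V : Type} {idx : V → ℕ} {W : ℕ} {σ : State V}
    (hσ : σ.Fits W) (e : Expr V) : ∀ (r : ℕ) (s : Store), s.Represents idx σ → e.Ok W σ →
    ∃ s' : Store, Exec W (e.compile idx r) s e.cost s' ∧ s'.reg (2 * r + 1) = e.eval σ ∧
      s'.mem = s.mem ∧ (∀ x, s'.reg (2 * x) = s.reg (2 * x)) ∧
      ∀ x < r, s'.reg (2 * x + 1) = s.reg (2 * x + 1) := by
  induction e with
  | const c =>
    intro r s _ ho
    refine ⟨_, .const s _ c ho, by simp [Store.setReg_reg], rfl, fun x => ?_, fun x hx => ?_⟩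
    · rw [Store.setReg_reg, if_neg (by omega)]
    · rw [Store.setReg_reg, if_neg (by omega)]
  | var x =>
    intro r s hs _
    refine ⟨_, .copy s _ _ (by rw [hs.1]; exact hσ.1 x), by simp [Store.setReg_reg, hs.1], rfl,
      fun x => ?_, fun x hx => ?_⟩
    · rw [Store.setReg_reg, if_neg (by omega)]
    · rw [Store.setReg_reg, if_neg (by omega)]
  | mem e ih =>
    intro r s hs ho
    obtain ⟨s₁, h₁, hv, hm, he, hlt⟩ := ih r s hs ho
    refine ⟨_, .seq h₁ (.load s₁ _ _ (by rw [hm, hs.2]; exact hσ.2 _)), ?_, hm, fun x => ?_,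
      fun x hx => ?_⟩
    · simp [Store.setReg_reg, hv, hm, hs.2]
    · rw [Store.setReg_reg, if_neg (by omega), he]
    · rw [Store.setReg_reg, if_neg (by omega), hlt x hx]
  | bin o a b iha ihb =>
    intro r s hs ho
    have hoa : a.Ok W σ := by cases o <;> exact ho.1
    have hob : b.Ok W σ := by cases o <;> first | exact ho.2.1 | exact ho.2
    obtain ⟨s₁, h₁, hv₁, hm₁, he₁, hlt₁⟩ := iha r s hs hoa
    obtain ⟨s₂, h₂, hv₂, hm₂, he₂, hlt₂⟩ := ihb (r + 1) s₁ (hs.congr hm₁ he₁) hob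
    have e₁ : s₂.reg (2 * r + 1) = a.eval σ := by rw [hlt₂ r (by omega), hv₁]
    have e₂ : s₂.reg (2 * r + 3) = b.eval σ := hv₂
    have h₃ := Exec.arith (W := W) s₂ o (2 * r + 1) (2 * r + 1) (2 * r + 3)
      (by rw [e₁, e₂]; exact Ok.eval_le hσ (e := .bin o a b) ho)
    refine ⟨_, (Exec.seq h₁ (.seq h₂ h₃)).of_eq (by simp only [cost]; omega), ?_,
      hm₂.trans hm₁, fun x => ?_, fun x hx => ?_⟩
    · simp [Store.setReg_reg, e₁, e₂, eval]
    · rw [Store.setReg_reg, if_neg (by omega), he₂, he₁]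
    · rw [Store.setReg_reg, if_neg (by omega), hlt₂ x (by omega), hlt₁ x hx]
  | mod a b iha ihb =>
    intro r s hs ho
    obtain ⟨s₁, h₁, hv₁, hm₁, he₁, hlt₁⟩ := iha r s hs ho.1
    obtain ⟨s₂, h₂, hv₂, hm₂, he₂, hlt₂⟩ := ihb (r + 1) s₁ (hs.congr hm₁ he₁) ho.2
    have e₁ : s₂.reg (2 * r + 1) = a.eval σ := by rw [hlt₂ r (by omega), hv₁]
    have e₂ : s₂.reg (2 * r + 3) = b.eval σ := hv₂
    -- The remainder is computed as `a - a / b * b`. No intermediate result exceeds `a`, so nothing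
    -- overflows, and `b = 0` agrees with the convention `a % 0 = a`.
    have hle : a.eval σ ≤ W := Ok.eval_le hσ ho.1
    have h₃ := Exec.arith (W := W) s₂ .div (2 * r + 5) (2 * r + 1) (2 * r + 3)
      (by rw [e₁, e₂]; exact (Nat.div_le_self _ _).trans hle)
    set s₃ := s₂.setReg (2 * r + 5) (Op.div.eval (s₂.reg (2 * r + 1)) (s₂.reg (2 * r + 3)))
      with hs₃
    have f₁ : s₃.reg (2 * r + 1) = a.eval σ := by simp [hs₃, Store.setReg_reg, e₁]
    have f₂ : s₃.reg (2 * r + 3) = b.eval σ := by simp [hs₃, Store.setReg_reg, e₂]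
    have f₃ : s₃.reg (2 * r + 5) = a.eval σ / b.eval σ := by
      simp [hs₃, Store.setReg_reg, e₁, e₂, Op.eval]
    have h₄ := Exec.arith (W := W) s₃ .mul (2 * r + 5) (2 * r + 5) (2 * r + 3)
      (by rw [f₂, f₃]; exact (Nat.div_mul_le_self _ _).trans hle)
    set s₄ := s₃.setReg (2 * r + 5) (Op.mul.eval (s₃.reg (2 * r + 5)) (s₃.reg (2 * r + 3)))
      with hs₄
    have g₁ : s₄.reg (2 * r + 1) = a.eval σ := by simp [hs₄, Store.setReg_reg, f₁]
    have g₃ : s₄.reg (2 * r + 5) = a.eval σ / b.eval σ * b.eval σ := by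
      simp [hs₄, Store.setReg_reg, f₂, f₃, Op.eval]
    have h₅ := Exec.arith (W := W) s₄ .sub (2 * r + 1) (2 * r + 1) (2 * r + 5)
      (by rw [g₁, g₃]; exact (Nat.sub_le _ _).trans hle)
    refine ⟨_, (Exec.seq h₁ (.seq h₂ (.seq h₃ (.seq h₄ h₅)))).of_eq
      (by simp only [cost]; omega), ?_, hm₂.trans hm₁, fun x => ?_,
      fun x hx => ?_⟩
    · simp only [Store.setReg_reg, if_true, g₁, g₃, Op.eval, eval]
      have := Nat.div_add_mod (a.eval σ) (b.eval σ)
      rw [Nat.mul_comm] at this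
      omega
    · rw [Store.setReg_reg, if_neg (by omega), hs₄, Store.setReg_reg, if_neg (by omega), hs₃,
        Store.setReg_reg, if_neg (by omega), he₂, he₁]
    · rw [Store.setReg_reg, if_neg (by omega), hs₄, Store.setReg_reg, if_neg (by omega), hs₃,
        Store.setReg_reg, if_neg (by omega), hlt₂ x (by omega), hlt₁ x hx]

/-! ### Commands: meaning, cost, code and program logic. -/

namespace Cmd

variable {V : Type} [DecidableEq V]

/-- The variables that a command may change. -/
def writes : Cmd V → List V
  | .skip => []
  | .assign x _ => [x]
  | .store _ _ => []
  | .seq p q => p.writes ++ q.writes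
  | .ite _ _ p q => p.writes ++ q.writes
  | .forLoop i _ c => i :: c.writes

/-- The command does not write to the memory. -/
def KeepsMem : Cmd V → Prop
  | .skip => True
  | .assign _ _ => True
  | .store _ _ => False
  | .seq p q => p.KeepsMem ∧ q.KeepsMem
  | .ite _ _ p q => p.KeepsMem ∧ q.KeepsMem
  | .forLoop _ _ c => c.KeepsMem

/-- The state after `j` rounds of a loop with counter `i` and body `f`. -/
def iter (i : V) (f : State V → State V) (σ : State V) : ℕ → State V
  | 0 => σ.setReg i 0
  | j + 1 => (f (iter i f σ j)).setReg i (j + 1)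

/-- The state after running a command. -/
def eval : Cmd V → State V → State V
  | .skip, σ => σ
  | .assign x e, σ => σ.setReg x (e.eval σ)
  | .store a e, σ => σ.setMem (a.eval σ) (e.eval σ)
  | .seq p q, σ => q.eval (p.eval σ)
  | .ite a b p q, σ => if a.eval σ ≤ b.eval σ then p.eval σ else q.eval σ
  | .forLoop i n c, σ => iter i c.eval σ (σ.reg n)

/-- The command runs from `σ` without overflow on words with the numbers `0, …, W`, and the number
of rounds of a loop with bound `n` is at most `ρ n`. -/
def Ok (W : ℕ) (ρ : V → ℕ) : Cmd V → State V → Prop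
  | .skip, _ => True
  | .assign _ e, σ => e.Ok W σ
  | .store a e, σ => a.Ok W σ ∧ e.Ok W σ
  | .seq p q, σ => p.Ok W ρ σ ∧ q.Ok W ρ (p.eval σ)
  | .ite a b p q, σ => a.Ok W σ ∧ b.Ok W σ ∧
      if a.eval σ ≤ b.eval σ then p.Ok W ρ σ else q.Ok W ρ σ
  | .forLoop i n c, σ => i ≠ n ∧ i ∉ c.writes ∧ n ∉ c.writes ∧ σ.reg n ≤ ρ n ∧
      ∀ j < σ.reg n, c.Ok W ρ (iter i c.eval σ j)

/-- An upper bound on the number of steps of a command, if `ρ` bounds the numbers of rounds. -/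
def cost (ρ : V → ℕ) : Cmd V → ℕ
  | .skip => 1
  | .assign _ e => e.cost + 1
  | .store a e => a.cost + e.cost + 1
  | .seq p q => p.cost ρ + q.cost ρ
  | .ite a b p q => a.cost + b.cost + 1 + (p.cost ρ + q.cost ρ)
  | .forLoop _ n c => ρ n * (c.cost ρ + 3) + 2

/-- The code of a command. -/
def compile (idx : V → ℕ) : Cmd V → Prog
  | .skip => .skip
  | .assign x e => .seq (e.compile idx 0) (.copy (2 * idx x) 1)
  | .store a e => .seq (a.compile idx 0) (.seq (e.compile idx 1) (.store 1 3))
  | .seq p q => .seq (p.compile idx) (q.compile idx)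
  | .ite a b p q => .seq (a.compile idx 0) (.seq (b.compile idx 1)
      (.ite 1 3 (p.compile idx) (q.compile idx)))
  | .forLoop i n c => .seq (.const (2 * idx i) 0) (.loop (2 * idx i) (2 * idx n)
      (.seq (c.compile idx) (.seq (.const 1 1) (.arith .add (2 * idx i) (2 * idx i) 1))))

theorem iter_reg {i : V} {f : State V → State V} {l : List V}
    (hf : ∀ σ x, x ∉ l → (f σ).reg x = σ.reg x) (σ : State V) {x : V} (hi : x ≠ i) (hx : x ∉ l) :
    ∀ j, (iter i f σ j).reg x = σ.reg x
  | 0 => by simp [iter, hi]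
  | j + 1 => by simp [iter, hi, hf _ _ hx, iter_reg hf σ hi hx j]

theorem iter_counter (i : V) (f : State V → State V) (σ : State V) :
    ∀ j, (iter i f σ j).reg i = j
  | 0 => by simp [iter]
  | j + 1 => by simp [iter]

/-- This and `eval_mem` are syntactic frame rules. Assertions about a block then need to mention
only what it computes, because `Spec.weaken` supplies the rest. -/
theorem eval_reg {x : V} : ∀ {c : Cmd V} {σ : State V}, x ∉ c.writes →
    (c.eval σ).reg x = σ.reg x := by
  intro c
  induction c with
  | skip => intros; rfl
  | assign y e =>
    intro σ h
    rw [writes, List.mem_singleton] at h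
    simp [eval, h]
  | store a e => intros; rfl
  | seq p q ihp ihq =>
    intro σ h
    rw [writes, List.mem_append, not_or] at h
    rw [eval, ihq h.2, ihp h.1]
  | ite a b p q ihp ihq =>
    intro σ h
    rw [writes, List.mem_append, not_or] at h
    rw [eval]
    split_ifs
    exacts [ihp h.1, ihq h.2]
  | forLoop i n c ih =>
    intro σ h
    rw [writes, List.mem_cons, not_or] at h
    rw [eval]
    have : ∀ j, (iter i c.eval σ j).reg x = σ.reg x := by
      intro j
      induction j with
      | zero => simp [iter, h.1]
      | succ j ihj => simp [iter, h.1, ih h.2, ihj]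
    exact this _

theorem eval_mem : ∀ {c : Cmd V} {σ : State V}, c.KeepsMem → (c.eval σ).mem = σ.mem := by
  intro c
  induction c with
  | skip => intros; rfl
  | assign y e => intros; rfl
  | store a e => intro σ h; exact h.elim
  | seq p q ihp ihq => intro σ h; rw [eval, ihq h.2, ihp h.1]
  | ite a b p q ihp ihq =>
    intro σ h
    rw [eval]
    split_ifs
    exacts [ihp h.1, ihq h.2]
  | forLoop i n c ih =>
    intro σ h
    have : ∀ j, (iter i c.eval σ j).mem = σ.mem := by
      intro j
      induction j with
      | zero => simp [iter]
      | succ j ihj => simp [iter, ih h, ihj]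
    exact this _

theorem _root_.WordRAM.Store.Represents.setReg {idx : V → ℕ} (hidx : idx.Injective) {s : Store}
    {σ : State V} (h : s.Represents idx σ) (x : V) (v : ℕ) :
    (s.setReg (2 * idx x) v).Represents idx (σ.setReg x v) := by
  refine ⟨fun y => ?_, h.2⟩
  rw [Store.setReg_reg]
  by_cases hy : y = x
  · subst hy; simp
  · rw [if_neg (fun e => hy (hidx (by omega))), State.setReg_reg_of_ne _ _ hy, h.1]

/-- Compiled commands do what they should, in the time that `cost` says. -/
theorem exec_compile {idx : V → ℕ} (hidx : idx.Injective) {W : ℕ} (hW : 1 ≤ W) {ρ : V → ℕ}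
    (c : Cmd V) : ∀ (σ : State V) (s : Store), σ.Fits W → s.Represents idx σ → c.Ok W ρ σ →
    ∃ (m : ℕ) (s' : Store), Exec W (c.compile idx) s m s' ∧ m ≤ c.cost ρ ∧
      s'.Represents idx (c.eval σ) ∧ (c.eval σ).Fits W := by
  induction c with
  | skip => exact fun σ s hσ hs _ => ⟨1, s, .skip s, le_rfl, hs, hσ⟩
  | assign x e =>
    intro σ s hσ hs ho
    obtain ⟨s₁, h₁, hv, hm, he, -⟩ := e.exec_compile hσ 0 s hs ho
    have hle := Expr.Ok.eval_le hσ ho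
    refine ⟨_, _, .seq h₁ (.copy s₁ _ 1 (by rw [hv]; exact hle)), le_rfl, ?_, hσ.setReg x hle⟩
    rw [show s₁.reg 1 = e.eval σ from hv]
    exact (hs.congr hm he).setReg hidx x _
  | store a e =>
    intro σ s hσ hs ho
    obtain ⟨s₁, h₁, hv₁, hm₁, he₁, -⟩ := a.exec_compile hσ 0 s hs ho.1
    have hs₁ := hs.congr hm₁ he₁
    obtain ⟨s₂, h₂, hv₂, hm₂, he₂, hlt₂⟩ := e.exec_compile hσ 1 s₁ hs₁ ho.2
    have hs₂ := hs₁.congr hm₂ he₂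
    have hle := Expr.Ok.eval_le hσ ho.2
    have e₁ : s₂.reg 1 = a.eval σ := (hlt₂ 0 (by omega)).trans hv₁
    have e₂ : s₂.reg 3 = e.eval σ := hv₂
    refine ⟨_, _, .seq h₁ (.seq h₂ (.store s₂ 1 3 (by rw [e₂]; exact hle))),
      by simp [cost, Nat.add_assoc], ?_, hσ.setMem _ hle⟩
    rw [e₁, e₂]
    exact ⟨hs₂.1, by simp [Store.setMem, eval, State.setMem, hs₂.2]⟩
  | seq p q ihp ihq =>
    intro σ s hσ hs ho
    obtain ⟨m₁, s₁, h₁, hm₁, hs₁, hf₁⟩ := ihp σ s hσ hs ho.1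
    obtain ⟨m₂, s₂, h₂, hm₂, hs₂, hf₂⟩ := ihq _ s₁ hf₁ hs₁ ho.2
    exact ⟨_, s₂, .seq h₁ h₂, Nat.add_le_add hm₁ hm₂, hs₂, hf₂⟩
  | ite a b p q ihp ihq =>
    intro σ s hσ hs ho
    obtain ⟨s₁, h₁, hv₁, hm₁, he₁, -⟩ := a.exec_compile hσ 0 s hs ho.1
    have hs₁ := hs.congr hm₁ he₁
    obtain ⟨s₂, h₂, hv₂, hm₂, he₂, hlt₂⟩ := b.exec_compile hσ 1 s₁ hs₁ ho.2.1
    have hs₂ := hs₁.congr hm₂ he₂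
    have e₁ : s₂.reg 1 = a.eval σ := (hlt₂ 0 (by omega)).trans hv₁
    have e₂ : s₂.reg 3 = b.eval σ := hv₂
    have ho₂ := ho.2.2
    rw [eval]
    by_cases hab : a.eval σ ≤ b.eval σ
    · rw [if_pos hab] at ho₂ ⊢
      obtain ⟨m, s₃, h₃, hm₃, hs₃, hf₃⟩ := ihp σ s₂ hσ hs₂ ho₂
      refine ⟨_, s₃, .seq h₁ (.seq h₂ (.ite_true (by rwa [e₁, e₂]) h₃)), ?_, hs₃, hf₃⟩
      simp only [cost]; omega
    · rw [if_neg hab] at ho₂ ⊢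
      obtain ⟨m, s₃, h₃, hm₃, hs₃, hf₃⟩ := ihq σ s₂ hσ hs₂ ho₂
      refine ⟨_, s₃, .seq h₁ (.seq h₂ (.ite_false (by rwa [e₁, e₂]) h₃)), ?_, hs₃, hf₃⟩
      simp only [cost]; omega
  | forLoop i n c ih =>
    intro σ s hσ hs ho
    obtain ⟨hin, hi, hn, hρ, ho⟩ := ho
    set N := σ.reg n with hN
    have hreg : ∀ j, (iter i c.eval σ j).reg n = N :=
      iter_reg (fun _ _ => eval_reg) σ hin.symm hn
    -- Induction on the number `d` of remaining rounds: `Exec` unfolds a loop from its first round,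
    -- whereas `iter` is built up from its last.
    have key : ∀ d j, j + d = N → ∀ s : Store, s.Represents idx (iter i c.eval σ j) →
        (iter i c.eval σ j).Fits W → ∃ (m : ℕ) (s' : Store),
        Exec W (.loop (2 * idx i) (2 * idx n) (.seq (c.compile idx)
          (.seq (.const 1 1) (.arith .add (2 * idx i) (2 * idx i) 1)))) s m s' ∧
        m ≤ d * (c.cost ρ + 3) + 1 ∧ s'.Represents idx (iter i c.eval σ N) ∧
        (iter i c.eval σ N).Fits W := by
      intro d
      induction d with
      | zero =>
        intro j hj s hs hf
        obtain rfl : j = N := by omega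
        refine ⟨1, s, .loop_done ?_, by omega, hs, hf⟩
        rw [hs.1, hs.1, iter_counter, hreg]
        exact lt_irrefl _
      | succ d ihd =>
        intro j hj s hs hf
        obtain ⟨m₁, s₁, h₁, hm₁, hs₁, hf₁⟩ := ih _ s hf hs (ho j (by omega))
        have hlt : s.reg (2 * idx i) < s.reg (2 * idx n) := by
          rw [hs.1, hs.1, iter_counter, hreg]; omega
        have hNW : N ≤ W := hσ.1 n
        have ej : s₁.reg (2 * idx i) = j := by rw [hs₁.1, eval_reg hi, iter_counter]
        have h₂ := Exec.const (W := W) s₁ 1 1 hW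
        have e₁ : (s₁.setReg 1 1).reg (2 * idx i) = j := by
          rw [Store.setReg_reg, if_neg (by omega), ej]
        have e₂ : (s₁.setReg 1 1).reg 1 = 1 := by simp [Store.setReg_reg]
        have h₃ := Exec.arith (W := W) (s₁.setReg 1 1) .add (2 * idx i) (2 * idx i) 1
          (by rw [e₁, e₂]; show j + 1 ≤ W; omega)
        rw [e₁, e₂] at h₃
        have hs₃ := (hs₁.setOdd 0 1).setReg hidx i (j + 1)
        obtain ⟨m₄, s₄, h₄, hm₄, hs₄, hf₄⟩ := ihd (j + 1) (by omega) _ hs₃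
          (hf₁.setReg i (by omega))
        refine ⟨_, s₄, .loop_step hlt (.seq h₁ (.seq h₂ h₃)) h₄, ?_, hs₄, hf₄⟩
        rw [Nat.succ_mul]; omega
    obtain ⟨m, s', h, hm, hs', hf'⟩ := key N 0 (by omega) _ (hs.setReg hidx i 0)
      (hσ.setReg i (Nat.zero_le _))
    refine ⟨_, s', .seq (.const s _ 0 (Nat.zero_le _)) h, ?_, hs', hf'⟩
    have : N * (c.cost ρ + 3) ≤ ρ n * (c.cost ρ + 3) := Nat.mul_le_mul_right _ hρ
    simp only [cost]; omega

/-! ### Correctness assertions -/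

/-- The command runs from `σ` without overflow, and `Q` holds afterwards. -/
def Spec (W : ℕ) (ρ : V → ℕ) (c : Cmd V) (σ : State V) (Q : State V → Prop) : Prop :=
  c.Ok W ρ σ ∧ Q (c.eval σ)

variable {W : ℕ} {ρ : V → ℕ} {σ : State V} {Q : State V → Prop}

@[simp] theorem spec_skip : Spec W ρ .skip σ Q ↔ Q σ := by simp [Spec, Ok, eval]

@[simp] theorem spec_assign {x : V} {e : Expr V} :
    Spec W ρ (.assign x e) σ Q ↔ e.Ok W σ ∧ Q (σ.setReg x (e.eval σ)) := Iff.rfl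

@[simp] theorem spec_store {a e : Expr V} : Spec W ρ (.store a e) σ Q ↔
    a.Ok W σ ∧ e.Ok W σ ∧ Q (σ.setMem (a.eval σ) (e.eval σ)) := by
  simp [Spec, Ok, eval, and_assoc]

@[simp] theorem spec_seq {p q : Cmd V} :
    Spec W ρ (.seq p q) σ Q ↔ Spec W ρ p σ fun σ' => Spec W ρ q σ' Q := by
  simp [Spec, Ok, eval, and_assoc]

@[simp] theorem spec_ite {a b : Expr V} {p q : Cmd V} : Spec W ρ (.ite a b p q) σ Q ↔
    a.Ok W σ ∧ b.Ok W σ ∧ (a.eval σ ≤ b.eval σ → Spec W ρ p σ Q) ∧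
      (b.eval σ < a.eval σ → Spec W ρ q σ Q) := by
  simp only [Spec, Ok, eval, and_assoc, ← not_le]
  split_ifs with h <;> simp [h]

/-- Weaken an assertion, remembering what the command leaves unchanged. -/
theorem Spec.weaken {c : Cmd V} {R : State V → Prop} (h : Spec W ρ c σ R)
    (hR : ∀ σ' : State V, (∀ x ∉ c.writes, σ'.reg x = σ.reg x) →
      (c.KeepsMem → σ'.mem = σ.mem) → R σ' → Q σ') : Spec W ρ c σ Q :=
  ⟨h.1, hR _ (fun _ => eval_reg) eval_mem h.2⟩

/-- The loop rule. -/
theorem Spec.forLoop {i n : V} {c : Cmd V} (I : ℕ → State V → Prop) (hin : i ≠ n)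
    (hi : i ∉ c.writes) (hn : n ∉ c.writes) (hρ : σ.reg n ≤ ρ n) (h0 : I 0 (σ.setReg i 0))
    (hs : ∀ j < σ.reg n, ∀ σ' : State V, σ'.reg i = j →
      (∀ x, x ≠ i → x ∉ c.writes → σ'.reg x = σ.reg x) → (c.KeepsMem → σ'.mem = σ.mem) →
      I j σ' → Spec W ρ c σ' fun σ'' => I (j + 1) (σ''.setReg i (j + 1))) :
    Spec W ρ (.forLoop i n c) σ (I (σ.reg n)) := by
  have hm : ∀ j, c.KeepsMem → (iter i c.eval σ j).mem = σ.mem := by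
    intro j hc
    induction j with
    | zero => rfl
    | succ j ih => simp [iter, eval_mem hc, ih]
  have key : ∀ j, j < σ.reg n → I j (iter i c.eval σ j) →
      Spec W ρ c (iter i c.eval σ j) fun σ'' => I (j + 1) (σ''.setReg i (j + 1)) :=
    fun j hj h => hs j hj _ (iter_counter _ _ _ _)
      (fun x hxi hx => iter_reg (fun _ _ => eval_reg) σ hxi hx j) (hm j) h
  have hI : ∀ j, j ≤ σ.reg n → I j (iter i c.eval σ j) := by
    intro j
    induction j with
    | zero => exact fun _ => h0
    | succ j ih => exact fun hj => (key j hj (ih (by omega))).2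
  exact ⟨⟨hin, hi, hn, hρ, fun j hj => (key j hj (hI j hj.le)).1⟩, hI _ le_rfl⟩

end Cmd

end WordRAM

/-! ## The dynamic program over the bags -/

/-- The parameters of the dynamic program: the numbers of vertices and time steps, the capped
numbers `k` and `ℓ`, the address of the adjacency matrices in the memory, and the sequence of their
entries. -/
structure TimelineDP where
  n : ℕ
  T : ℕ
  k : ℕ
  ℓ : ℕ
  off : ℕ
  a : ℕ → ℕ

namespace TimelineDP

open Finset

variable (D : TimelineDP)

/-- The number of digits that belong to one activity interval: digits divisible by `L` stand for
inactivity. -/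
def L : ℕ := D.ℓ + 2

/-- The number of states of a vertex. -/
def S : ℕ := D.k * D.L + 1

/-- A strict upper bound on the number of temporal edges. -/
def E : ℕ := D.T * D.n * D.n + 1

/-- The entry `j` of the list of all pairs of a time step and a vertex is a neighbour of `v`. -/
def Incident (v j : ℕ) : Prop := 1 ≤ D.a ((j / D.n * D.n + v) * D.n + j % D.n)

/-- The vertex `v` is in bag `q`.  Bag `0` is empty, and bag `i + 1` belongs to time step `i`. -/
def Bag (q v : ℕ) : Prop :=
  (∃ j < D.T * D.n, D.Incident v j ∧ j / D.n + 1 ≤ q) ∧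
    ∃ j < D.T * D.n, D.Incident v j ∧ q ≤ j / D.n + 1

open Classical in
/-- The base of the digit of `v` in the codes for bag `q`. -/
noncomputable def base (q v : ℕ) : ℕ := if D.Bag q v then D.S else 1

/-- The digit of `v` in the code `X` for bag `q`. -/
noncomputable def digit (q X v : ℕ) : ℕ := X / (∏ u ∈ range v, D.base q u) % D.base q v

open Classical in
/-- The digit of `v` in the code `X` for bag `i`, as far as `v` is still in the next bag. -/
noncomputable def kept (i X v : ℕ) : ℕ := if D.Bag (i + 1) v then D.digit i X v else 0

/-- The smallest digit that may follow the digit `d`. -/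
def succDigit (d : ℕ) : ℕ := if 1 ≤ d % D.L then d + 1 else d

open Classical in
/-- The number of edges that are covered at time `i` if `Y` is the code for bag `i + 1`. -/
noncomputable def gain (i Y : ℕ) : ℕ :=
  #{j ∈ range (D.n * D.n) | j / D.n + 1 ≤ j % D.n ∧ 1 ≤ D.a (i * (D.n * D.n) + j) ∧
    1 ≤ D.digit (i + 1) Y (j / D.n) % D.L + D.digit (i + 1) Y (j % D.n) % D.L}

/-- The transitions of the dynamic program.  An entry `x` consists of the code `x / E` and the
number `x % E` of covered edges. -/
def Step (i x y : ℕ) : Prop :=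
  (∀ v < D.n, D.succDigit (D.kept i (x / D.E) v) ≤ D.digit (i + 1) (y / D.E) v) ∧
    y % D.E ≤ x % D.E + D.gain i (y / D.E)

/-- The maximum number of codes for a bag. -/
noncomputable def P : ℕ := (range D.T).sup (fun i => ∏ v ∈ range D.n, D.base (i + 1) v) ⊔ 1

/-- The number of entries in a layer of the table. -/
noncomputable def N : ℕ := D.E * D.P

/-- The table entries that are marked after `J` rounds. -/
def marks : ℕ → Set ℕ
  | 0 => {0}
  | J + 1 => {z | z ∈ marks J ∨ z = (J / (D.N * D.N) + 1) * D.N + J % D.N ∧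
      J / D.N ∈ marks J ∧ D.Step (J / (D.N * D.N)) (J / D.N % D.N) (J % D.N)}

theorem one_le_S : 1 ≤ D.S := Nat.le_add_left 1 _

theorem one_le_base (q v : ℕ) : 1 ≤ D.base q v := by
  unfold base
  split_ifs
  exacts [D.one_le_S, le_rfl]

end TimelineDP

set_option linter.unusedSimpArgs false

/-! ## The program -/

namespace TimelineDP

open WordRAM WordRAM.Expr Finset

/-- The variables of the program. -/
inductive Var
  | ans | n | T | k | ℓ | L | S | E | P | N | tot | t | off | act | tab | Tn | Tnn | nn | TNN
  | i | entry | cx | cy | q | v | j | f | g | b | r | d | e | ok | J | m | gain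
  deriving DecidableEq

local infixr:60 " ;; " => Cmd.seq

/-- The value of a variable. -/
abbrev val (z : Var) : Expr Var := .var z

/-- Compute the base `b` and the membership bit `r` of the vertex `v` for bag `q`. -/
def baseCmd : Cmd Var :=
  .assign .f 0 ;; .assign .g 0 ;;
  .forLoop .j .Tn
    (.ite 1 (mem (val .off + ((val .j / val .n * val .n + val .v) * val .n + val .j % val .n)))
      (.ite (val .j / val .n + 1) (val .q) (.assign .f 1) .skip ;;
        .ite (val .q) (val .j / val .n + 1) (.assign .g 1) .skip)
      .skip) ;;
  .assign .r (val .f * val .g) ;; .assign .b (1 + val .r * (val .S - 1))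

/-- Compute the maximum number `P` of codes for a bag. -/
def maxCmd : Cmd Var :=
  .assign .P 1 ;;
  .forLoop .i .T
    (.assign .q (val .i + 1) ;; .assign .m 1 ;;
      .forLoop .v .n (baseCmd ;; .assign .m (val .m * val .b)) ;;
      .ite (val .P) (val .m) (.assign .P (val .m)) .skip)

/-- Split off the digits of the vertex `v` in the codes `cx` and `cy` for the bags `i` and `i + 1`,
compare them, and store the activity of `v`. -/
def digitCmd : Cmd Var :=
  .assign .q (val .i) ;; baseCmd ;;
  .assign .d (val .cx % val .b) ;; .assign .cx (val .cx / val .b) ;;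
  .assign .q (val .i + 1) ;; baseCmd ;;
  .assign .d (val .d * val .r) ;;
  .assign .e (val .cy % val .b) ;; .assign .cy (val .cy / val .b) ;;
  .ite 1 (val .d % val .L) (.assign .d (val .d + 1)) .skip ;;
  .ite (val .d) (val .e) .skip (.assign .ok 0) ;;
  .store (val .act + val .v) (val .e % val .L)

/-- Compare the codes `cx` and `cy` for the bags `i` and `i + 1`, and store the activities. -/
def compareCmd : Cmd Var :=
  .assign .ok 1 ;; .forLoop .v .n digitCmd

/-- Count the edges that are covered at time `i`. -/
def gainCmd : Cmd Var :=
  .assign .gain 0 ;;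
  .forLoop .j .nn
    (.ite (val .j / val .n + 1) (val .j % val .n)
      (.ite 1 (mem (val .off + (val .i * val .nn + val .j)))
        (.ite 1 (mem (val .act + val .j / val .n) + mem (val .act + val .j % val .n))
          (.assign .gain (val .gain + 1)) .skip) .skip) .skip)

/-- One round of the dynamic program. -/
def roundCmd : Cmd Var :=
  .assign .i (val .J / val .N / val .N) ;;
  .assign .cx (val .J / val .N % val .N / val .E) ;;
  .assign .cy (val .J % val .N / val .E) ;;
  compareCmd ;; gainCmd ;;
  .ite 1 (val .ok)
    (.ite (val .J % val .N % val .E) (val .J / val .N % val .N % val .E + val .gain)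
      (.ite 1 (mem (val .tab + val .J / val .N))
        (.store (val .tab + ((val .i + 1) * val .N + val .J % val .N)) 1) .skip) .skip) .skip

/-- Fill the table. -/
def tableCmd : Cmd Var :=
  .assign .N (val .E * val .P) ;; .assign .TNN (val .T * val .N * val .N) ;;
  .store (val .tab) 1 ;; .forLoop .J .TNN roundCmd

/-- Search the last layer of the table. -/
def searchCmd : Cmd Var :=
  .assign .ans 0 ;;
  .forLoop .entry .N
    (.ite 1 (mem (val .tab + (val .T * val .N + val .entry)))
      (.ite (val .t) (val .entry % val .E) (.assign .ans 1) .skip) .skip)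

/-- Count all edges. -/
def countCmd : Cmd Var :=
  .assign .tot 0 ;;
  .forLoop .j .Tnn
    (.ite (val .j / val .n % val .n + 1) (val .j % val .n)
      (.ite 1 (mem (val .off + val .j)) (.assign .tot (val .tot + 1)) .skip) .skip)

/-- Read the numbers in front of the adjacency matrices, which start at address `c`. -/
def readCmd (c : ℕ) : Cmd Var :=
  .assign .n (mem 0) ;; .assign .T (mem 1) ;; .assign .k (mem 2) ;; .assign .ℓ (mem 3) ;;
  .ite (val .k) (val .T) .skip (.assign .k (val .T)) ;;
  .ite (val .ℓ) (val .T) .skip (.assign .ℓ (val .T)) ;;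
  .assign .off (.const c) ;; .assign .Tn (val .T * val .n) ;; .assign .Tnn (val .Tn * val .n)

/-- Set the constants. -/
def constCmd : Cmd Var :=
  .assign .nn (val .n * val .n) ;; .assign .L (val .ℓ + 2) ;;
  .assign .S (val .k * val .L + 1) ;; .assign .E (val .Tnn + 1) ;;
  .assign .act (val .off + val .Tnn) ;; .assign .tab (val .act + val .n)

/-- The whole program.  The adjacency matrices start at address `c`, and the expression `t` is the
number of edges to be covered. -/
def program (c : ℕ) (t : Expr Var) : Cmd Var :=
  readCmd c ;; countCmd ;; .assign .t t ;;
  .ite (val .Tnn) 0 (.ite (val .t) 0 (.assign .ans 1) .skip)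
    (constCmd ;; maxCmd ;; tableCmd ;; searchCmd)

/-- The variables that are set once at the beginning. -/
def constants : List Var :=
  [.n, .T, .L, .S, .E, .t, .off, .act, .tab, .Tn, .Tnn, .nn]

variable (D : TimelineDP)

/-- The largest number that occurs in a run of the program. -/
noncomputable def room : ℕ :=
  D.off + D.T * D.n * D.n + D.n + (D.T + 1) * D.N + D.T * D.N * D.N + D.S + 2 * D.L + D.E + 10

/-- The constants have their values, and the input is in the memory. -/
structure Ready (σ : State Var) : Prop where
  n : σ.reg .n = D.n
  T : σ.reg .T = D.T
  L : σ.reg .L = D.L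
  S : σ.reg .S = D.S
  E : σ.reg .E = D.E
  off : σ.reg .off = D.off
  act : σ.reg .act = D.off + D.T * D.n * D.n
  tab : σ.reg .tab = D.off + D.T * D.n * D.n + D.n
  Tn : σ.reg .Tn = D.T * D.n
  Tnn : σ.reg .Tnn = D.T * D.n * D.n
  nn : σ.reg .nn = D.n * D.n
  mem : ∀ j < D.T * D.n * D.n, σ.mem (D.off + j) = D.a j

/-! ### Correctness of the blocks of the program. -/

variable {D} {W : ℕ} {ρ : Var → ℕ} {σ σ' : State Var}

theorem Ready.congr (h : D.Ready σ) (hr : ∀ z ∈ constants, σ'.reg z = σ.reg z)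
    (hm : ∀ j < D.T * D.n * D.n, σ'.mem (D.off + j) = σ.mem (D.off + j)) : D.Ready σ' := by
  simp only [constants, List.forall_mem_cons] at hr
  obtain ⟨h₁, h₂, h₃, h₄, h₅, -, h₇, h₈, h₉, h₁₀, h₁₁, h₁₂, -⟩ := hr
  exact ⟨h₁.trans h.n, h₂.trans h.T, h₃.trans h.L, h₄.trans h.S, h₅.trans h.E, h₇.trans h.off,
    h₈.trans h.act, h₉.trans h.tab, h₁₀.trans h.Tn, h₁₁.trans h.Tnn, h₁₂.trans h.nn,
    fun j hj => (hm j hj).trans (h.mem j hj)⟩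

theorem Ready.setReg (h : D.Ready σ) {z : Var} (hz : z ∉ constants) (w : ℕ) :
    D.Ready (σ.setReg z w) :=
  h.congr (fun _ hy => State.setReg_reg_of_ne _ _ fun e => hz (e ▸ hy)) fun _ _ => rfl

theorem Ready.frame (h : D.Ready σ) {l : List Var} (hr : ∀ z ∉ l, σ'.reg z = σ.reg z)
    (hl : ∀ z ∈ constants, z ∉ l) (hm : σ'.mem = σ.mem) : D.Ready σ' :=
  h.congr (fun z hz => hr z (hl z hz)) fun _ _ => by rw [hm]

theorem entry_lt {n T j v : ℕ} (hj : j < T * n) (hv : v < n) :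
    (j / n * n + v) * n + j % n < T * n * n := by
  have hn : 0 < n := by omega
  have h₁ : j / n < T := Nat.div_lt_of_lt_mul (by rwa [Nat.mul_comm])
  have h₂ : j % n < n := Nat.mod_lt _ hn
  have h₃ : (j / n + 1) * n ≤ T * n := Nat.mul_le_mul_right _ h₁
  have h₄ : (j / n * n + v + 1) * n ≤ T * n * n :=
    Nat.mul_le_mul_right _ (by rw [Nat.add_mul] at h₃; omega)
  rw [Nat.add_mul (_ + _)] at h₄
  omega

-- The flags `f` and `g` record the two halves of `Bag`. Their product is the membership bit `r`,
-- and `1 + r * (S - 1)` is `S` or `1` accordingly.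
open Classical in
theorem spec_baseCmd (hσ : D.Ready σ) (hW : D.room ≤ W) (hρ : D.T * D.n ≤ ρ .Tn)
    (hv : σ.reg .v < D.n) : Cmd.Spec W ρ baseCmd σ fun σ' =>
      σ'.reg .r = (if D.Bag (σ.reg .q) (σ.reg .v) then 1 else 0) ∧
      σ'.reg .b = D.base (σ.reg .q) (σ.reg .v) := by
  unfold room at hW
  have hS := D.one_le_S
  rw [baseCmd]
  simp only [Cmd.spec_seq, Cmd.spec_assign, ok_ofNat, eval_ofNat]
  refine ⟨by omega, by omega, ?_⟩
  refine Cmd.Spec.weaken (Cmd.Spec.forLoop (fun m σ' =>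
    (σ'.reg .f = if ∃ j < m, D.Incident (σ.reg .v) j ∧ j / D.n + 1 ≤ σ.reg .q then 1 else 0) ∧
    (σ'.reg .g = if ∃ j < m, D.Incident (σ.reg .v) j ∧ σ.reg .q ≤ j / D.n + 1 then 1 else 0))
    (by decide) (by decide) (by decide) ?_ ?_ ?_) ?_
  · simpa [hσ.Tn] using hρ
  · simp
  · intro j hj τ hτj hτ hτm hI
    simp only [State.setReg_reg_of_ne, ne_eq, reduceCtorEq, not_false_eq_true, hσ.Tn] at hj
    have en : τ.reg .n = D.n := by rw [hτ _ (by decide) (by decide)]; simp [hσ.n]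
    have eo : τ.reg .off = D.off := by rw [hτ _ (by decide) (by decide)]; simp [hσ.off]
    have ev : τ.reg .v = σ.reg .v := by rw [hτ _ (by decide) (by decide)]; simp
    have eq : τ.reg .q = σ.reg .q := by rw [hτ _ (by decide) (by decide)]; simp
    have hidx := entry_lt hj hv
    have em : τ.mem (D.off + ((j / D.n * D.n + σ.reg .v) * D.n + j % D.n)) =
        D.a ((j / D.n * D.n + σ.reg .v) * D.n + j % D.n) := by
      rw [hτm (by simp [Cmd.KeepsMem])]; exact hσ.mem _ hidx
    have hmul := Nat.le_mul_of_pos_right (j / D.n * D.n + σ.reg .v) (by omega : 0 < D.n)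
    have hjn : j / D.n ≤ D.T * D.n := (Nat.div_le_self _ _).trans hj.le
    have hTn := Nat.le_mul_of_pos_right (D.T * D.n) (by omega : 0 < D.n)
    obtain ⟨hf, hg⟩ := hI
    simp only [Cmd.spec_ite, Cmd.spec_seq, Cmd.spec_assign, Cmd.spec_skip, ok_ofNat, ok_mem,
      ok_add, ok_mul, ok_div, ok_mod, ok_var, eval_ofNat, eval_mem, eval_add, eval_mul, eval_div,
      eval_mod, eval_var, hτj, en, eo, ev, eq, em, true_and, Nat.exists_lt_succ_right]
    have hInc : D.Incident (σ.reg .v) j ↔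
      1 ≤ D.a ((j / D.n * D.n + σ.reg .v) * D.n + j % D.n) := Iff.rfl
    simp only [State.setReg_reg_of_ne, State.setReg_reg_self, ne_eq, reduceCtorEq,
      not_false_eq_true, hτj, en, eq, hInc, hf, hg]
    refine ⟨by omega, by omega, fun h => ⟨by omega, fun h₁ => ⟨by omega, by omega, fun h₂ =>
      ⟨by omega, ?_⟩, fun h₂ => ?_⟩, fun h₁ => ⟨by omega, fun h₂ => ⟨by omega, ?_⟩,
      fun h₂ => ?_⟩⟩, fun h => ?_⟩
    · simp [h, h₁, h₂]
    · simp [h, h₁, h₂.not_ge]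
    · simp [h, h₁.not_ge, h₂]
    · omega
    · simp [h.not_ge]
  · intro τ hτ hτm hI
    have eS : τ.reg .S = D.S := by rw [hτ _ (by decide)]; simp [hσ.S]
    have eT : ((σ.setReg .f 0).setReg .g 0).reg .Tn = D.T * D.n := by simp [hσ.Tn]
    rw [eT] at hI
    simp only [ok_mul, ok_var, eval_mul, eval_var, ok_add, ok_ofNat, ok_sub,
      eval_ofNat, eval_add, eval_sub, hI.1, hI.2, State.setReg_reg_self, true_and, ne_eq,
      reduceCtorEq, not_false_eq_true, State.setReg_reg_of_ne, eS]
    refine ⟨?_, ⟨by omega, ?_, ?_⟩, ?_⟩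
    · split_ifs <;> omega
    · split_ifs <;> simp <;> omega
    · split_ifs <;> simp <;> omega
    · have hBag : D.Bag (σ.reg .q) (σ.reg .v) ↔ _ ∧ _ := Iff.rfl
      by_cases hA : ∃ j < D.T * D.n, D.Incident (σ.reg .v) j ∧ j / D.n + 1 ≤ σ.reg .q <;>
      by_cases hB : ∃ j < D.T * D.n, D.Incident (σ.reg .v) j ∧ σ.reg .q ≤ j / D.n + 1 <;>
      simp only [base, hBag, hA, hB, if_true, if_false, and_self, and_true, and_false,
        Nat.mul_zero, Nat.zero_mul, Nat.one_mul, Nat.add_zero, Nat.add_sub_cancel' hS]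

/-- Bag `0` is empty and has a single code, which the `⊔ 1` in `P` accounts for. Every other bag `q`
occurs in the supremum at index `q - 1`. -/
theorem prod_base_le_P {q : ℕ} (hq : q ≤ D.T) : ∏ v ∈ range D.n, D.base q v ≤ D.P := by
  cases q with
  | zero =>
    have : ∀ v, D.base 0 v = 1 := fun v => if_neg fun h => by
      obtain ⟨⟨j, -, -, hj⟩, -⟩ := h; exact Nat.not_succ_le_zero _ hj
    simp [this, P]
  | succ i =>
    exact (le_sup (f := fun i => ∏ v ∈ range D.n, D.base (i + 1) v) (mem_range.2 hq)).trans
      le_sup_left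

theorem prod_base_mono (q : ℕ) {m n : ℕ} (h : m ≤ n) :
    ∏ v ∈ range m, D.base q v ≤ ∏ v ∈ range n, D.base q v :=
  prod_le_prod_of_subset_of_one_le' (range_subset_range.2 h) fun v _ _ => D.one_le_base q v

/-- Linear arithmetic treats the products in `room` as atoms, so the comparisons between them are
collected here. -/
theorem N_le_room (hT : 0 < D.T) : D.P ≤ D.N ∧ D.N ≤ (D.T + 1) * D.N ∧
    D.N * D.N ≤ D.T * D.N * D.N ∧ D.T * D.N ≤ (D.T + 1) * D.N ∧ D.T ≤ D.T * D.N := by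
  have hP : 1 ≤ D.P := le_sup_right
  have hE : 1 ≤ D.E := Nat.le_add_left _ _
  have hN : 1 ≤ D.N := Nat.mul_pos hE hP
  refine ⟨Nat.le_mul_of_pos_left _ hE, Nat.le_mul_of_pos_left _ (by omega), ?_,
    Nat.mul_le_mul_right _ (by omega), Nat.le_mul_of_pos_right _ hN⟩
  exact Nat.mul_le_mul_right _ (Nat.le_mul_of_pos_left _ hT)

theorem spec_maxCmd (hσ : D.Ready σ) (hW : D.room ≤ W) (hT : 0 < D.T) (hn : 0 < D.n)
    (hρ : D.T * D.n ≤ ρ .Tn) (hρn : D.n ≤ ρ .n) (hρT : D.T ≤ ρ .T) :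
    Cmd.Spec W ρ maxCmd σ fun σ' => σ'.reg .P = D.P := by
  have hN := N_le_room hT
  have hW' := hW
  unfold room at hW
  rw [maxCmd]
  simp only [Cmd.spec_seq, Cmd.spec_assign, ok_ofNat, eval_ofNat]
  refine ⟨by omega, ?_⟩
  refine Cmd.Spec.weaken (Cmd.Spec.forLoop (fun m τ => τ.reg .P =
    (range m).sup (fun i => ∏ v ∈ range D.n, D.base (i + 1) v) ⊔ 1)
    (by decide) (by decide) (by decide) ?_ ?_ ?_) ?_
  · simpa [hσ.T] using hρT
  · simp
  · intro i hi τ hτi hτ hτm hI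
    simp only [State.setReg_reg_of_ne, ne_eq, reduceCtorEq, not_false_eq_true, hσ.T] at hi
    have hR : D.Ready τ := (hσ.setReg (z := .P) (by decide) 1).congr
      (fun z hz => hτ z (by revert z; decide) (by revert z; decide))
      fun j _ => by rw [hτm (by simp [Cmd.KeepsMem, baseCmd])]
    simp only [ok_add, ok_var, ok_ofNat, eval_add, eval_ofNat, eval_var, hτi, true_and,
      Cmd.spec_seq, Cmd.spec_assign]
    refine ⟨by omega, by omega, ?_⟩
    set τ' := (τ.setReg .q (i + 1)).setReg .m 1 with hτ'
    have hR' : D.Ready τ' := (hR.setReg (by decide) _).setReg (by decide) _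
    refine Cmd.Spec.weaken (Cmd.Spec.forLoop (fun m τ => τ.reg .m =
      ∏ v ∈ range m, D.base (i + 1) v) (by decide) (by decide) (by decide) ?_ ?_ ?_) ?_
    · simpa [hR'.n] using hρn
    · simp [hτ']
    · intro v hv μ hμv hμ hμm hJ
      rw [hR'.n] at hv
      have hR₂ : D.Ready μ := hR'.congr
        (fun z hz => hμ z (by revert z; decide) (by revert z; decide))
        fun j _ => by rw [hμm (by simp [Cmd.KeepsMem, baseCmd])]
      have eq : μ.reg .q = i + 1 := by rw [hμ _ (by decide) (by decide)]; simp [hτ']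
      rw [Cmd.spec_seq]
      refine (spec_baseCmd hR₂ hW' hρ (by omega)).weaken fun ν hν _ h => ?_
      simp only [Cmd.spec_assign, ok_mul, ok_var, true_and, eval_mul, eval_var, h.2, hμv, eq,
        hν .m (by decide), hJ, ← prod_range_succ]
      have h₁ := prod_base_mono (D := D) (i + 1) (show v + 1 ≤ D.n by omega)
      have h₂ := prod_base_le_P (D := D) (q := i + 1) (by omega)
      exact ⟨by omega, by simp⟩
    · intro μ hμ hμm hJ
      rw [hR'.n] at hJ
      have eP : μ.reg .P = τ.reg .P := by rw [hμ _ (by decide)]; simp [hτ']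
      simp only [Cmd.spec_ite, Cmd.spec_assign, Cmd.spec_skip, ok_var, eval_var, hJ, eP, hI,
        true_and, range_add_one, sup_insert, ne_eq, reduceCtorEq, not_false_eq_true,
        State.setReg_reg_of_ne, State.setReg_reg_self]
      constructor
      · intro h
        rw [sup_assoc, sup_eq_left.2 h]
      · intro h
        rw [sup_assoc, sup_eq_right.2 h.le]
  · intro τ _ _ hI
    simpa [hσ.T, P] using hI

theorem digit_lt (q X v : ℕ) : D.digit q X v < D.base q v := Nat.mod_lt _ (D.one_le_base q v)

theorem base_le_S (q v : ℕ) : D.base q v ≤ D.S := by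
  unfold base
  split_ifs
  exacts [le_rfl, D.one_le_S]

/-- The memory cells for the activities hold the activities of the first `m` vertices. -/
noncomputable def actMem (D : TimelineDP) (q Y m : ℕ) (μ : ℕ → ℕ) (z : ℕ) : ℕ :=
  if D.off + D.T * D.n * D.n ≤ z ∧ z < D.off + D.T * D.n * D.n + m then
    D.digit q Y (z - (D.off + D.T * D.n * D.n)) % D.L
  else μ z

-- Mixed radix decoding: `cx` and `cy` are the codes divided by the bases of all earlier vertices,
-- so a remainder gives the digit of the current vertex and a division removes it. The proposition
-- `B` stands for the outcome of the earlier comparisons.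
open Classical in
theorem spec_digitCmd (hσ : D.Ready σ) (hW : D.room ≤ W) (hT : 0 < D.T)
    (hρ : D.T * D.n ≤ ρ .Tn) (hv : σ.reg .v < D.n) (hi : σ.reg .i < D.T) {X Y : ℕ} {B : Prop}
    {μ : ℕ → ℕ}
    (hX : σ.reg .cx = X / ∏ u ∈ range (σ.reg .v), D.base (σ.reg .i) u)
    (hY : σ.reg .cy = Y / ∏ u ∈ range (σ.reg .v), D.base (σ.reg .i + 1) u)
    (hok : σ.reg .ok = if B then 1 else 0)
    (hmem : σ.mem = D.actMem (σ.reg .i + 1) Y (σ.reg .v) μ) :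
    Cmd.Spec W ρ digitCmd σ fun σ' =>
      σ'.reg .cx = X / ∏ u ∈ range (σ.reg .v + 1), D.base (σ.reg .i) u ∧
      σ'.reg .cy = Y / ∏ u ∈ range (σ.reg .v + 1), D.base (σ.reg .i + 1) u ∧
      σ'.reg .ok = (if B ∧ D.succDigit (D.kept (σ.reg .i) X (σ.reg .v)) ≤
        D.digit (σ.reg .i + 1) Y (σ.reg .v) then 1 else 0) ∧
      σ'.mem = D.actMem (σ.reg .i + 1) Y (σ.reg .v + 1) μ := by
  have hN := N_le_room hT
  have hW' := hW
  unfold room at hW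
  rw [digitCmd]
  simp only [Cmd.spec_seq, Cmd.spec_assign, ok_var, eval_var, true_and]
  refine (spec_baseCmd (hσ.setReg (z := .q) (by decide) _) hW' hρ
    (by simpa using hv)).weaken fun τ hτ hτm h => ?_
  replace h := h.2
  rw [State.setReg_reg_self, State.setReg_reg_of_ne _ _ (by decide)] at h
  have hτm := hτm (by simp [Cmd.KeepsMem, baseCmd])
  have ex : τ.reg .cx = σ.reg .cx := by rw [hτ _ (by decide)]; simp
  have ei : τ.reg .i = σ.reg .i := by rw [hτ _ (by decide)]; simp
  simp only [ok_mod, ok_div, ok_add, ok_ofNat, ok_var, eval_var, eval_mod, eval_div, eval_add,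
    eval_ofNat, true_and, ne_eq, reduceCtorEq, not_false_eq_true, State.setReg_reg_of_ne, h, ex,
    ei, hX, Nat.div_div_eq_div_mul, ← prod_range_succ, and_self, and_true]
  refine ⟨by omega, ?_⟩
  have hR : D.Ready τ := (hσ.setReg (z := .q) (by decide) _).frame hτ (by decide) hτm
  have hv' : τ.reg .v = σ.reg .v := by rw [hτ _ (by decide)]; simp
  refine (spec_baseCmd (((hR.setReg (z := .d) (by decide) _).setReg (z := .cx) (by decide) _).setReg
    (z := .q) (by decide) _) hW' hρ
    (by simpa [hv'] using hv)).weaken fun ν hν hνm h => ?_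
  have hνm := hνm (by simp [Cmd.KeepsMem, baseCmd])
  rw [State.setReg_reg_self, State.setReg_reg_of_ne _ _ (by decide),
    State.setReg_reg_of_ne _ _ (by decide), State.setReg_reg_of_ne _ _ (by decide), hv'] at h
  have ed : ν.reg .d = D.digit (σ.reg .i) X (σ.reg .v) := by rw [hν _ (by decide)]; simp [digit]
  have ex : ν.reg .cx = X / ∏ u ∈ range (σ.reg .v + 1), D.base (σ.reg .i) u := by
    rw [hν _ (by decide)]; simp
  have ey : ν.reg .cy = σ.reg .cy := by rw [hν _ (by decide)]; simp [hτ .cy (by decide)]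
  have eo : ν.reg .ok = σ.reg .ok := by rw [hν _ (by decide)]; simp [hτ .ok (by decide)]
  have ev : ν.reg .v = σ.reg .v := by rw [hν _ (by decide)]; simp [hv']
  have eL : ν.reg .L = D.L := by rw [hν _ (by decide)]; simp [hR.L]
  have ea : ν.reg .act = D.off + D.T * D.n * D.n := by rw [hν _ (by decide)]; simp [hR.act]
  have em : ν.mem = D.actMem (σ.reg .i + 1) Y (σ.reg .v) μ := by
    rw [hνm, ← hmem]; exact hτm
  have ek : ν.reg .d * ν.reg .r = D.kept (σ.reg .i) X (σ.reg .v) := by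
    rw [ed, h.1, kept]; split_ifs <;> simp
  have hkS : D.kept (σ.reg .i) X (σ.reg .v) < D.S := by
    have h₁ := digit_lt (D := D) (σ.reg .i) X (σ.reg .v)
    have h₂ := base_le_S (D := D) (σ.reg .i) (σ.reg .v)
    rw [kept]; split_ifs <;> omega
  have hy : ν.reg .cy % ν.reg .b = D.digit (σ.reg .i + 1) Y (σ.reg .v) := by
    rw [ey, h.2, hY, digit]
  have hy' : ν.reg .cy / ν.reg .b = Y / ∏ u ∈ range (σ.reg .v + 1), D.base (σ.reg .i + 1) u := by
    rw [ey, h.2, hY, Nat.div_div_eq_div_mul, prod_range_succ]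
  -- All branches of the two conditionals end with the same store, which is verified once for any
  -- state with the right registers and memory.
  have key : ∀ μ' : State Var, μ'.reg .cx = ν.reg .cx →
      μ'.reg .cy = ν.reg .cy / ν.reg .b → μ'.reg .ok = (if B ∧
        D.succDigit (D.kept (σ.reg .i) X (σ.reg .v)) ≤
        D.digit (σ.reg .i + 1) Y (σ.reg .v) then 1 else 0) →
      μ'.reg .e = D.digit (σ.reg .i + 1) Y (σ.reg .v) → μ'.reg .L = ν.reg .L →
      μ'.reg .v = ν.reg .v → μ'.reg .act = ν.reg .act → μ'.mem = ν.mem →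
      Cmd.Spec W ρ (.store (val .act + val .v) (val .e % val .L)) μ' fun σ' =>
      σ'.reg .cx = X / ∏ u ∈ range (σ.reg .v + 1), D.base (σ.reg .i) u ∧
      σ'.reg .cy = Y / ∏ u ∈ range (σ.reg .v + 1), D.base (σ.reg .i + 1) u ∧
      σ'.reg .ok = (if B ∧ D.succDigit (D.kept (σ.reg .i) X (σ.reg .v)) ≤
        D.digit (σ.reg .i + 1) Y (σ.reg .v) then 1 else 0) ∧
      σ'.mem = D.actMem (σ.reg .i + 1) Y (σ.reg .v + 1) μ := by
    intro μ' h₁ h₂ h₃ h₄ h₅ h₆ h₇ h₈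
    simp only [Cmd.spec_store, ok_add, ok_var, true_and, eval_var, ok_mod, eval_add, eval_mod,
      h₁, h₂, h₃, h₄, h₅, h₆, h₇, State.setMem_reg, ex, hy', ev, ea, eL, and_true]
    refine ⟨by omega, ?_⟩
    funext z
    by_cases hz : z = D.off + D.T * D.n * D.n + σ.reg .v
    · subst hz
      rw [State.setMem_mem_self, actMem, if_pos (by omega), Nat.add_sub_cancel_left]
    · rw [State.setMem_mem_of_ne _ _ hz, h₈, em, actMem, actMem]
      congr 1
      exact propext ⟨fun h => by omega, fun h => by omega⟩
  simp only [Cmd.spec_ite, Cmd.spec_assign, Cmd.spec_skip, ok_mod, ok_div, ok_add, ok_mul,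
    ok_ofNat, ok_var, eval_var, eval_mod, eval_div, eval_add, eval_mul, eval_ofNat, true_and, ne_eq,
    reduceCtorEq, not_false_eq_true, State.setReg_reg_of_ne, State.setReg_reg_self, and_self, ek,
    eL, hy]
  have hsucc : ∀ d, 1 ≤ d % D.L → D.succDigit d = d + 1 := fun d h => if_pos h
  have hsucc' : ∀ d, d % D.L < 1 → D.succDigit d = d := fun d h => if_neg (by omega)
  refine ⟨by omega, by omega, fun h₁ => ⟨by omega, fun h₂ => ?_, fun h₂ => ⟨by omega, ?_⟩⟩,
    fun h₁ => ⟨fun h₂ => ?_, fun h₂ => ⟨by omega, ?_⟩⟩⟩ <;>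
  refine key _ ?_ ?_ ?_ ?_ ?_ ?_ ?_ ?_ <;>
  first
    | rfl
    | simp [hsucc _ h₁, h₂, h₂.not_ge, eo, hok, hy, eL]
    | simp [hsucc' _ h₁, h₂, h₂.not_ge, eo, hok, hy, eL]
    | simp [hsucc _ h₁, h₂, eo, hok, hy, eL]
    | simp [hsucc' _ h₁, h₂, eo, hok, hy, eL]

theorem actMem_of_lt {q Y m z : ℕ} {μ : ℕ → ℕ} (h : z < D.off + D.T * D.n * D.n) :
    D.actMem q Y m μ z = μ z := if_neg (by omega)

theorem actMem_of_ge {q Y m z : ℕ} {μ : ℕ → ℕ} (h : D.off + D.T * D.n * D.n + m ≤ z) :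
    D.actMem q Y m μ z = μ z := if_neg (by omega)

theorem actMem_add {q Y m v : ℕ} {μ : ℕ → ℕ} (h : v < m) :
    D.actMem q Y m μ (D.off + D.T * D.n * D.n + v) = D.digit q Y v % D.L := by
  rw [actMem, if_pos (by omega), Nat.add_sub_cancel_left]

open Classical in
theorem spec_compareCmd (hσ : D.Ready σ) (hW : D.room ≤ W) (hT : 0 < D.T)
    (hρ : D.T * D.n ≤ ρ .Tn) (hρn : D.n ≤ ρ .n) (hi : σ.reg .i < D.T) :
    Cmd.Spec W ρ compareCmd σ fun σ' =>
      σ'.reg .ok = (if ∀ v < D.n, D.succDigit (D.kept (σ.reg .i) (σ.reg .cx) v) ≤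
        D.digit (σ.reg .i + 1) (σ.reg .cy) v then 1 else 0) ∧
      σ'.mem = D.actMem (σ.reg .i + 1) (σ.reg .cy) D.n σ.mem := by
  have hW' := hW
  unfold room at hW
  rw [compareCmd]
  simp only [Cmd.spec_seq, Cmd.spec_assign, ok_ofNat, eval_ofNat]
  refine ⟨by omega, ?_⟩
  have hR := hσ.setReg (z := .ok) (by decide) 1
  refine Cmd.Spec.weaken (Cmd.Spec.forLoop (fun m τ =>
    τ.reg .cx = σ.reg .cx / ∏ u ∈ range m, D.base (σ.reg .i) u ∧
    τ.reg .cy = σ.reg .cy / ∏ u ∈ range m, D.base (σ.reg .i + 1) u ∧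
    τ.reg .ok = (if ∀ v < m, D.succDigit (D.kept (σ.reg .i) (σ.reg .cx) v) ≤
        D.digit (σ.reg .i + 1) (σ.reg .cy) v then 1 else 0) ∧
    τ.mem = D.actMem (σ.reg .i + 1) (σ.reg .cy) m σ.mem)
    (by decide) (by decide) (by decide) ?_ ?_ ?_) ?_
  · simpa [hσ.n] using hρn
  · refine ⟨by simp, by simp, by simp, ?_⟩
    funext z
    exact (if_neg (by omega)).symm
  · intro v hv τ hτv hτ _ hI
    rw [hR.n] at hv
    have ei : τ.reg .i = σ.reg .i := by rw [hτ _ (by decide) (by decide)]; simp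
    have hRτ : D.Ready τ := hR.congr (fun z hz => hτ z (by revert z; decide)
      (by revert z; decide)) fun j hj => by rw [hI.2.2.2, actMem_of_lt (by omega)]; rfl
    rw [← ei, ← hτv] at hI
    refine (spec_digitCmd hRτ hW' hT hρ (by omega) (by omega) hI.1 hI.2.1
      (hI.2.2.1.trans (by congr)) hI.2.2.2).weaken fun ν _ _ h => ?_
    rw [ei, hτv] at h
    simp only [Nat.forall_lt_succ_right, State.setReg_mem, ne_eq, reduceCtorEq, not_false_eq_true,
      State.setReg_reg_of_ne]
    exact ⟨h.1, h.2.1, h.2.2.1.trans (by congr), h.2.2.2⟩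
  · intro τ _ _ hI
    rw [hR.n] at hI
    exact hI.2.2

/-- Every edge is counted once, at the matrix entry above the diagonal. The sum of the two stored
residues is positive exactly if an endpoint is active. -/
theorem spec_gainCmd (hσ : D.Ready σ) (hW : D.room ≤ W)
    (hρ : D.n * D.n ≤ ρ .nn) (hi : σ.reg .i < D.T) {Y : ℕ} {μ : ℕ → ℕ}
    (hmem : σ.mem = D.actMem (σ.reg .i + 1) Y D.n μ) :
    Cmd.Spec W ρ gainCmd σ fun σ' => σ'.reg .gain = D.gain (σ.reg .i) Y := by
  classical
  have hW' := hW
  unfold room at hW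
  rw [gainCmd]
  simp only [Cmd.spec_seq, Cmd.spec_assign, ok_ofNat, eval_ofNat]
  refine ⟨by omega, ?_⟩
  have hR := hσ.setReg (z := .gain) (by decide) 0
  set p : ℕ → Prop := fun j => j / D.n + 1 ≤ j % D.n ∧
    1 ≤ D.a (σ.reg .i * (D.n * D.n) + j) ∧ 1 ≤ D.digit (σ.reg .i + 1) Y (j / D.n) % D.L +
      D.digit (σ.reg .i + 1) Y (j % D.n) % D.L with hp
  refine Cmd.Spec.weaken (Cmd.Spec.forLoop (fun m τ => τ.reg .gain = #{j ∈ range m | p j})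
    (by decide) (by decide) (by decide) ?_ ?_ ?_) ?_
  · simpa [hσ.nn] using hρ
  · simp
  · intro j hj τ hτj hτ hτm hI
    have hτm := hτm (by simp [Cmd.KeepsMem])
    rw [hR.nn] at hj
    have hRτ : D.Ready τ := hR.congr (fun z hz => hτ z (by revert z; decide)
      (by revert z; decide)) fun j hj => by rw [hτm]
    have ei : τ.reg .i = σ.reg .i := by rw [hτ _ (by decide) (by decide)]; simp
    have hn : 0 < D.n := Nat.pos_of_ne_zero fun h => by simp [h] at hj
    have h₁ : j / D.n < D.n := Nat.div_lt_of_lt_mul hj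
    have h₂ : j % D.n < D.n := Nat.mod_lt _ hn
    have h₃ : (σ.reg .i + 1) * (D.n * D.n) ≤ D.T * D.n * D.n := by
      rw [Nat.mul_assoc]; exact Nat.mul_le_mul_right _ hi
    rw [Nat.add_mul] at h₃
    have e₁ := hRτ.mem (σ.reg .i * (D.n * D.n) + j) (by omega)
    have hτm' : τ.mem = D.actMem (σ.reg .i + 1) Y D.n μ := by rw [hτm, ← hmem]; rfl
    have hL : 0 < D.L := Nat.succ_pos _
    have h₄ : D.digit (σ.reg .i + 1) Y (j / D.n) % D.L < D.L := Nat.mod_lt _ hL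
    have h₅ : D.digit (σ.reg .i + 1) Y (j % D.n) % D.L < D.L := Nat.mod_lt _ hL
    have hn₂ : D.n ≤ D.n * D.n := Nat.le_mul_of_pos_right _ hn
    have hc : #{j ∈ range j | p j} ≤ j := by
      simpa using card_filter_le (range j) p
    have hcp : p j → #{j ∈ range (j + 1) | p j} = #{j ∈ range j | p j} + 1 := fun h => by
      rw [range_add_one, filter_insert, if_pos h, card_insert_of_notMem (by simp)]
    have hcn : ¬ p j → #{j ∈ range (j + 1) | p j} = #{j ∈ range j | p j} := fun h => by
      rw [range_add_one, filter_insert, if_neg h]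
    simp only [Cmd.spec_ite, Cmd.spec_assign, Cmd.spec_skip, ok_ofNat, ok_mem,
      ok_add, ok_mul, ok_div, ok_mod, ok_var, eval_ofNat, eval_mem, eval_add, eval_mul, eval_div,
      eval_mod, eval_var, hτj, hRτ.n, hRτ.off, hRτ.nn, hRτ.act, ei, e₁, true_and,
      State.setReg_reg_self, ne_eq, reduceCtorEq, not_false_eq_true, State.setReg_reg_of_ne, hI]
    rw [hτm', actMem_add h₁, actMem_add h₂]
    refine ⟨by omega, fun h₆ => ⟨by omega, by omega, fun h₇ => ⟨by omega, by omega, fun h₈ =>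
      ⟨by omega, ?_⟩, fun h₈ => ?_⟩, fun h₇ => ?_⟩, fun h₆ => ?_⟩
    · exact (hcp ⟨h₆, h₇, h₈⟩).symm
    · exact (hcn fun h => by have := h.2.2; omega).symm
    · exact (hcn fun h => by have := h.2.1; omega).symm
    · exact (hcn fun h => by have := h.1; omega).symm
  · intro τ _ _ hI
    rw [hR.nn] at hI
    rw [hI, gain]

open Classical in
/-- The table holds the marks `Z`. -/
def Table (D : TimelineDP) (Z : Set ℕ) (μ : ℕ → ℕ) : Prop :=
  ∀ z, μ (D.off + D.T * D.n * D.n + D.n + z) = if z ∈ Z then 1 else 0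

theorem round_lt {N T J : ℕ} (hJ : J < T * N * N) : J / N / N < T ∧ J / N < T * N ∧
    J / N % N < N ∧ J % N < N := by
  have hN : 0 < N := Nat.pos_of_ne_zero fun h => by simp [h] at hJ
  have h₁ : J / N < T * N := Nat.div_lt_of_lt_mul (by rwa [Nat.mul_comm])
  exact ⟨Nat.div_lt_of_lt_mul (by rwa [Nat.mul_comm]), h₁, Nat.mod_lt _ hN, Nat.mod_lt _ hN⟩

/-- Input, activities and table occupy consecutive disjoint ranges of the memory, so overwriting the
activities harms neither of the others. A round sets at most one mark; in every branch without a
store the set of marks is unchanged (`hsame`). -/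
theorem spec_roundCmd (hσ : D.Ready σ) (hW : D.room ≤ W)
    (hρ : D.T * D.n ≤ ρ .Tn) (hρn : D.n ≤ ρ .n) (hρnn : D.n * D.n ≤ ρ .nn)
    (hN : σ.reg .N = D.N) (hJ : σ.reg .J < D.T * D.N * D.N)
    (hmem : D.Table (D.marks (σ.reg .J)) σ.mem) :
    Cmd.Spec W ρ roundCmd σ fun σ' => D.Table (D.marks (σ.reg .J + 1)) σ'.mem ∧
      ∀ j < D.T * D.n * D.n, σ'.mem (D.off + j) = σ.mem (D.off + j) := by
  have hT : 0 < D.T := Nat.pos_of_ne_zero fun h => by simp [h] at hJ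
  have hNr := N_le_room hT
  have hW' := hW
  unfold room at hW
  obtain ⟨hi, hJN, hx, hy⟩ := round_lt hJ
  rw [roundCmd]
  simp only [Cmd.spec_seq, Cmd.spec_assign, ok_div, ok_mod, ok_var, eval_div, eval_mod, eval_var,
    ne_eq, reduceCtorEq, not_false_eq_true, State.setReg_reg_of_ne, hN, hσ.E, and_self, true_and]
  set i := σ.reg .J / D.N / D.N with hi_def
  set x := σ.reg .J / D.N % D.N with hx_def
  set y := σ.reg .J % D.N with hy_def
  set τ := ((σ.setReg .i i).setReg .cx (x / D.E)).setReg .cy (y / D.E) with hτ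
  have hRτ : D.Ready τ := ((hσ.setReg (by decide) _).setReg (by decide) _).setReg (by decide) _
  have ei : τ.reg .i = i := by simp [hτ]
  have ex : τ.reg .cx = x / D.E := by simp [hτ]
  have ey : τ.reg .cy = y / D.E := by simp [hτ]
  refine (spec_compareCmd hRτ hW' hT hρ hρn (by rwa [ei])).weaken fun ν hν _ h => ?_
  rw [ei, ex, ey] at h
  have hRν : D.Ready ν := hRτ.congr (fun z hz => hν z (by revert z; decide)) fun j hj => by
    rw [h.2, actMem_of_lt (by omega)]
  have ei' : ν.reg .i = i := by rw [hν _ (by decide), ei]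
  have e₀ : ν.mem = D.actMem (ν.reg .i + 1) (y / D.E) D.n τ.mem := by rw [ei', h.2]
  refine (spec_gainCmd hRν hW' hρnn (by rwa [ei']) e₀).weaken fun θ hθ hθm hg => ?_
  have hθm := hθm (by simp [Cmd.KeepsMem, gainCmd])
  have eok : θ.reg .ok = ν.reg .ok := hθ _ (by decide)
  have eJ : θ.reg .J = σ.reg .J := by
    rw [hθ _ (by decide), hν _ (by decide)]; simp [hτ]
  have eN : θ.reg .N = D.N := by
    rw [hθ _ (by decide), hν _ (by decide)]; simp [hτ, hN]
  have ei'' : θ.reg .i = i := by rw [hθ _ (by decide), ei']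
  have hRθ : D.Ready θ := hRν.congr (fun z hz => hθ z (by revert z; decide)) fun j hj => by
    rw [hθm]
  have hTb : D.Table (D.marks (σ.reg .J)) θ.mem := fun z => by
    rw [hθm, h.2, actMem_of_ge (by omega)]
    exact hmem z
  have hIn : ∀ j < D.T * D.n * D.n, θ.mem (D.off + j) = σ.mem (D.off + j) := fun j hj => by
    rw [hθm, h.2, actMem_of_lt (by omega)]; rfl
  have hdst : (i + 1) * D.N + y < (D.T + 1) * D.N := by
    have : (i + 1 + 1) * D.N ≤ (D.T + 1) * D.N := Nat.mul_le_mul_right _ (by omega)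
    rw [Nat.add_mul (i + 1)] at this
    omega
  have hgE : D.gain i (y / D.E) ≤ D.n * D.n := by
    rw [gain]
    exact (card_filter_le _ _).trans (by simp)
  have hnn : D.n * D.n ≤ D.T * D.n * D.n := by
    rw [Nat.mul_assoc]; exact Nat.le_mul_of_pos_left _ hT
  have hmod : x % D.E < D.E := Nat.mod_lt _ (Nat.succ_pos _)
  -- The round number is read in base `N` as layer `i`, source `x` and target `y`. Hence `J / N = i
  -- * N + x` is the address of the source.
  have hmarks : ∀ z, z ∈ D.marks (σ.reg .J + 1) ↔ z ∈ D.marks (σ.reg .J) ∨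
      z = (i + 1) * D.N + y ∧ σ.reg .J / D.N ∈ D.marks (σ.reg .J) ∧ D.Step i x y := by
    intro z
    rw [hi_def, Nat.div_div_eq_div_mul]
    rfl
  have hsame : ¬ (σ.reg .J / D.N ∈ D.marks (σ.reg .J) ∧ D.Step i x y) →
      D.Table (D.marks (σ.reg .J + 1)) θ.mem := fun hne z => by
    rw [hTb z]
    congr 1
    exact propext ⟨fun hz => (hmarks z).2 (Or.inl hz),
      fun hz => ((hmarks z).1 hz).resolve_right fun h => hne h.2⟩
  simp only [Cmd.spec_ite, Cmd.spec_store, Cmd.spec_skip, ok_ofNat, ok_mem,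
    ok_add, ok_mul, ok_div, ok_mod, ok_var, eval_ofNat, eval_mem, eval_add, eval_mul, eval_div,
    eval_mod, eval_var, true_and, and_self, eJ, eN, ei'', hRθ.E, hRθ.tab, hg, ei', eok, h.1,
    ← hy_def, ← hx_def]
  rw [hTb]
  refine ⟨by omega, fun h₁ => ⟨by omega, fun h₂ => ⟨by omega, by omega, fun h₃ => ?_,
    fun h₃ => ⟨hsame ?_, hIn⟩⟩, fun h₂ => ⟨hsame ?_, hIn⟩⟩, fun h₁ => ⟨hsame ?_, hIn⟩⟩
  · have h₁' : ∀ v < D.n, D.succDigit (D.kept i (x / D.E) v) ≤ D.digit (i + 1) (y / D.E) v := by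
      by_contra hc; rw [if_neg hc] at h₁; omega
    have h₃' : σ.reg .J / D.N ∈ D.marks (σ.reg .J) := by
      by_contra hc; rw [if_neg hc] at h₃; omega
    have hmul : i + 1 ≤ (i + 1) * D.N := Nat.le_mul_of_pos_right _ (by omega)
    refine ⟨by omega, by omega, fun z => ?_, fun j hj => ?_⟩
    · by_cases hz : z = (i + 1) * D.N + y
      · rw [hz, State.setMem_mem_self, if_pos ((hmarks _).2 (Or.inr ⟨rfl, h₃', h₁', h₂⟩))]
      · rw [State.setMem_mem_of_ne _ _ (by omega), hTb]
        congr 1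
        exact propext ⟨fun h => (hmarks z).2 (Or.inl h),
          fun h => ((hmarks z).1 h).resolve_right fun h => hz h.1⟩
    · rw [State.setMem_mem_of_ne _ _ (by omega), hIn j hj]
  · intro hc; rw [if_pos hc.1] at h₃; omega
  · intro hc; have := hc.2.2; omega
  · intro hc; rw [if_pos hc.2.1] at h₁; omega

theorem spec_tableCmd (hσ : D.Ready σ) (hW : D.room ≤ W) (hT : 0 < D.T)
    (hρ : D.T * D.n ≤ ρ .Tn) (hρn : D.n ≤ ρ .n) (hρnn : D.n * D.n ≤ ρ .nn)
    (hρT : D.T * D.N * D.N ≤ ρ .TNN) (hP : σ.reg .P = D.P) (hmem : D.Table ∅ σ.mem) :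
    Cmd.Spec W ρ tableCmd σ fun σ' => D.Ready σ' ∧
      D.Table (D.marks (D.T * D.N * D.N)) σ'.mem ∧ σ'.reg .N = D.N := by
  have hNr := N_le_room hT
  have hW' := hW
  unfold room at hW
  have hN : D.E * D.P = D.N := rfl
  rw [tableCmd]
  simp only [Cmd.spec_seq, Cmd.spec_assign, Cmd.spec_store, ok_mul, ok_var, ok_ofNat, eval_mul,
    eval_var, eval_ofNat, true_and, hσ.E, hP, hN, ne_eq, reduceCtorEq, not_false_eq_true,
    State.setReg_reg_of_ne, State.setReg_reg_self, hσ.T, hσ.tab]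
  refine ⟨by omega, by omega, by omega, ?_⟩
  set τ := ((σ.setReg .N D.N).setReg .TNN (D.T * D.N * D.N)).setMem
    (D.off + D.T * D.n * D.n + D.n) 1 with hτ
  have hRτ : D.Ready τ := hσ.congr (fun z hz => by
    have h₁ : z ≠ .N := by rintro rfl; revert hz; decide
    have h₂ : z ≠ .TNN := by rintro rfl; revert hz; decide
    simp [hτ, h₁, h₂]) fun j hj => by
      rw [hτ, State.setMem_mem_of_ne _ _ (by omega)]; rfl
  have eT : τ.reg .TNN = D.T * D.N * D.N := by simp [hτ]
  refine Cmd.Spec.weaken (Cmd.Spec.forLoop (fun J θ => D.Table (D.marks J) θ.mem ∧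
    ∀ j < D.T * D.n * D.n, θ.mem (D.off + j) = τ.mem (D.off + j))
    (by decide) (by decide) (by decide) ?_ ?_ ?_) ?_
  · rwa [eT]
  -- The only initial mark is `0`: the code of the empty bag, with no edge covered.
  · refine ⟨fun z => ?_, fun j hj => rfl⟩
    by_cases hz : z = 0
    · subst hz
      simp [hτ, marks]
    · rw [State.setReg_mem, hτ, State.setMem_mem_of_ne _ _ (by omega)]
      simpa [marks, hz] using hmem z
  · intro J hJ θ hθJ hθ _ hI
    rw [eT] at hJ
    have hRθ : D.Ready θ := hRτ.congr (fun z hz => hθ z (by revert z; decide)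
      (by revert z; decide)) hI.2
    have eN : θ.reg .N = D.N := by rw [hθ _ (by decide) (by decide)]; simp [hτ]
    refine (spec_roundCmd hRθ hW' hρ hρn hρnn eN (by rwa [hθJ]) (by rw [hθJ]; exact hI.1)).weaken
      fun ν _ _ h => ?_
    rw [hθJ] at h
    exact ⟨h.1, fun j hj => (h.2 j hj).trans (hI.2 j hj)⟩
  · intro θ hθ _ hI
    rw [eT] at hI
    exact ⟨hRτ.congr (fun z hz => hθ z (by revert z; decide)) hI.2, hI.1,
      by rw [hθ _ (by decide)]; simp [hτ]⟩

open Classical in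
theorem spec_searchCmd (hσ : D.Ready σ) (hW : D.room ≤ W) (hT : 0 < D.T)
    (hρN : D.N ≤ ρ .N) (hN : σ.reg .N = D.N) {Z : Set ℕ} (hmem : D.Table Z σ.mem) :
    Cmd.Spec W ρ searchCmd σ fun σ' => σ'.reg .ans =
      if ∃ x < D.N, D.T * D.N + x ∈ Z ∧ σ.reg .t ≤ x % D.E then 1 else 0 := by
  have hNr := N_le_room hT
  unfold room at hW
  rw [searchCmd]
  simp only [Cmd.spec_seq, Cmd.spec_assign, ok_ofNat, eval_ofNat]
  refine ⟨by omega, ?_⟩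
  have eN : (σ.setReg .ans 0).reg .N = D.N := by simp [hN]
  refine Cmd.Spec.weaken (Cmd.Spec.forLoop (fun m τ => τ.reg .ans =
    if ∃ x < m, D.T * D.N + x ∈ Z ∧ σ.reg .t ≤ x % D.E then 1 else 0)
    (by decide) (by decide) (by decide) ?_ ?_ ?_) ?_
  · rwa [eN]
  · simp
  · intro x hx τ hτx hτ hτm hI
    rw [eN] at hx
    have hτm := hτm (by simp [Cmd.KeepsMem])
    have hr : ∀ z, z ≠ .ans → z ≠ .entry → τ.reg z = σ.reg z := fun z h₁ h₂ => by
      rw [hτ z h₂ (by simpa [Cmd.writes] using h₁), State.setReg_reg_of_ne _ _ h₁]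
    have hTb : τ.mem (D.off + D.T * D.n * D.n + D.n + (D.T * D.N + x)) =
        if D.T * D.N + x ∈ Z then 1 else 0 := by rw [hτm]; exact hmem _
    have hlast : D.T * D.N + D.N = (D.T + 1) * D.N := by ring
    simp only [Cmd.spec_ite, Cmd.spec_assign, Cmd.spec_skip, ok_ofNat, ok_mem, ok_add, ok_mul,
      ok_mod, ok_var, eval_ofNat, eval_mem, eval_add, eval_mul, eval_mod, eval_var, true_and,
      and_self, hr, ne_eq, reduceCtorEq, not_false_eq_true, hσ.tab, hσ.T, hN, hσ.E, hτx, hTb,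
      State.setReg_reg_of_ne, State.setReg_reg_self, hI, Nat.exists_lt_succ_right]
    refine ⟨by omega, by omega, fun h₁ => ⟨fun h₂ => ⟨by omega, ?_⟩, fun h₂ => ?_⟩, fun h₁ => ?_⟩
    · have hc : D.T * D.N + x ∈ Z := by
        by_contra hc; rw [if_neg hc] at h₁; omega
      rw [if_pos (Or.inr ⟨hc, h₂⟩)]
    · simp [h₂.not_ge]
    · have hc : D.T * D.N + x ∉ Z := fun hc => by rw [if_pos hc] at h₁; omega
      simp [hc]
  · intro τ _ _ hI
    rwa [eN] at hI

/-! ### Running time and correctness of the whole program. -/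

variable (D)

/-- The numbers of rounds of the loops of the program. -/
noncomputable def rounds : Var → ℕ
  | .n => D.n
  | .T => D.T
  | .nn => D.n * D.n
  | .Tn => D.T * D.n
  | .Tnn => D.T * D.n * D.n
  | .N => D.N
  | .TNN => D.T * D.N * D.N
  | _ => 0

open Classical in
/-- The loop bounds of the program, which stops early if there are no vertices or no time steps. -/
noncomputable def loopBound (x : Var) : ℕ := if D.T * D.n * D.n = 0 then 0 else D.rounds x

/-- The running time. -/
noncomputable def time : ℕ :=
  if D.T * D.n * D.n = 0 then 1 else D.P ^ 2 * (D.n + D.T + 2) ^ 10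

/-- The number of all edges. -/
def edgeCount : ℕ :=
  #{j ∈ range (D.T * D.n * D.n) | j / D.n % D.n + 1 ≤ j % D.n ∧ 1 ≤ D.a j}

/-- The dominant part is the table: `T * N * N` rounds, each treating `n` vertices by scans over `T
* n` pairs, hence the monomial `T ^ 2 * n ^ 2 * N ^ 2`. It bounds all other monomials, and `1000`
absorbs the coefficients. If `T * n * n = 0`, no loop runs even once. -/
theorem cost_program_le (c : ℕ) (t : Expr Var) :
    (program c t).cost D.loopBound ≤ (t.cost + 1000) * D.time := by
  unfold time
  split_ifs with h
  · have hz : D.loopBound = fun _ => 0 := funext fun x => if_pos h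
    simp only [program, readCmd, countCmd, constCmd, maxCmd, tableCmd, searchCmd, roundCmd,
      compareCmd, gainCmd, digitCmd, baseCmd, Cmd.cost, cost_ofNat, cost_const, cost_var, cost_mem,
      cost_add, cost_sub, cost_mul, cost_div, cost_mod, hz]
    omega
  · have hz : D.loopBound = D.rounds := funext fun x => if_neg h
    have hT : 1 ≤ D.T := Nat.pos_of_ne_zero fun e => h (by simp [e])
    have hn : 1 ≤ D.n := Nat.pos_of_ne_zero fun e => h (by simp [e])
    have hE : 1 ≤ D.E := Nat.le_add_left _ _
    have hP : 1 ≤ D.P := le_sup_right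
    have hN : 1 ≤ D.N := Nat.mul_pos hE hP
    -- Since `N = E * P` and `E` is at most cubic in `n + T + 2`, the degree is `2 + 2 + 6 = 10`.
    have hM : D.T ^ 2 * D.n ^ 2 * D.N ^ 2 ≤ D.P ^ 2 * (D.n + D.T + 2) ^ 10 := by
      have hE' : D.E ≤ (D.n + D.T + 2) ^ 3 := by
        rw [E]; nlinarith [Nat.zero_le (D.T * D.n), Nat.zero_le (D.n ^ 3), Nat.zero_le (D.T ^ 3),
          Nat.zero_le (D.T ^ 2 * D.n), Nat.zero_le (D.T * D.n ^ 2)]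
      calc D.T ^ 2 * D.n ^ 2 * D.N ^ 2 = D.P ^ 2 * (D.T ^ 2 * D.n ^ 2 * D.E ^ 2) := by
            rw [N]; ring
        _ ≤ D.P ^ 2 * ((D.n + D.T + 2) ^ 2 * (D.n + D.T + 2) ^ 2 *
            ((D.n + D.T + 2) ^ 3) ^ 2) := by gcongr <;> omega
        _ = _ := by ring
    have mono : ∀ i j l, i ≤ 2 → j ≤ 2 → l ≤ 2 →
        D.T ^ i * D.n ^ j * D.N ^ l ≤ D.T ^ 2 * D.n ^ 2 * D.N ^ 2 := fun i j l hi hj hl =>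
      Nat.mul_le_mul (Nat.mul_le_mul (Nat.pow_le_pow_right hT hi) (Nat.pow_le_pow_right hn hj))
        (Nat.pow_le_pow_right hN hl)
    refine le_trans ?_ (Nat.mul_le_mul_left _ hM)
    simp only [program, readCmd, countCmd, constCmd, maxCmd, tableCmd, searchCmd, roundCmd,
      compareCmd, gainCmd, digitCmd, baseCmd, Cmd.cost, cost_ofNat, cost_const, cost_var, cost_mem,
      cost_add, cost_sub, cost_mul, cost_div, cost_mod, hz, rounds, Nat.reduceAdd]
    have ht : t.cost ≤ t.cost * (D.T ^ 2 * D.n ^ 2 * D.N ^ 2) :=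
      Nat.le_mul_of_pos_right _ (by positivity)
    have h₀ := mono 0 0 0 (by omega) (by omega) (by omega)
    have h₁ := mono 1 0 0 (by omega) (by omega) (by omega)
    have h₂ := mono 1 1 0 (by omega) (by omega) (by omega)
    have h₃ := mono 1 1 2 (by omega) (by omega) (by omega)
    have h₄ := mono 1 2 0 (by omega) (by omega) (by omega)
    have h₅ := mono 1 2 2 (by omega) (by omega) (by omega)
    have h₆ := mono 1 0 2 (by omega) (by omega) (by omega)
    have h₇ := mono 2 2 0 (by omega) (by omega) (by omega)
    have h₈ := mono 0 0 1 (by omega) (by omega) (by omega)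
    linarith

variable {D}

/-- The initial memory `μ` holds the input with the parameters `D`. -/
structure Input (D : TimelineDP) (μ : ℕ → ℕ) : Prop where
  n : μ 0 = D.n
  T : μ 1 = D.T
  k : min (μ 2) D.T = D.k
  ℓ : min (μ 3) D.T = D.ℓ
  a : ∀ j, μ (D.off + j) = D.a j
  a_eq_zero : ∀ j, D.T * D.n * D.n ≤ j → D.a j = 0

theorem spec_readCmd {ρ : Var → ℕ} (hσ : D.Input σ.mem) (hans : σ.reg .ans = 0)
    (hW : D.off + D.T * D.n * D.n + 10 ≤ W) :
    Cmd.Spec W ρ (readCmd D.off) σ fun τ => τ.mem = σ.mem ∧ τ.reg .ans = 0 ∧ τ.reg .n = D.n ∧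
      τ.reg .T = D.T ∧ τ.reg .k = D.k ∧ τ.reg .ℓ = D.ℓ ∧ τ.reg .off = D.off ∧
      τ.reg .Tn = D.T * D.n ∧ τ.reg .Tnn = D.T * D.n * D.n := by
  -- This also covers `n = 0` with large `T`, so forming `T * n` is safe before the emptiness test.
  have hTn : D.T * D.n ≤ D.T * D.n * D.n := by
    rcases Nat.eq_zero_or_pos D.n with h | h
    · simp [h]
    · exact Nat.le_mul_of_pos_right _ h
  have hk := hσ.k
  have hℓ := hσ.ℓ
  simp only [readCmd, Cmd.spec_seq, Cmd.spec_assign, Cmd.spec_ite, Cmd.spec_skip, ok_mem, ok_ofNat,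
    ok_var, ok_const, ok_mul, eval_mem, eval_ofNat, eval_var, eval_const, eval_mul, true_and,
    State.setReg_mem, State.setReg_reg_self, ne_eq, reduceCtorEq, not_false_eq_true,
    State.setReg_reg_of_ne, hσ.n, hσ.T, hans, and_true]
  refine ⟨by omega, by omega, by omega, by omega, fun h₁ => ⟨fun h₂ => ?_, fun h₂ => ?_⟩,
    fun h₁ => ⟨fun h₂ => ?_, fun h₂ => ?_⟩⟩ <;>
  exact ⟨by omega, by omega, by omega, by omega, by omega⟩

theorem spec_countCmd {ρ : Var → ℕ} (hσ : D.Input σ.mem)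
    (hW : D.off + D.T * D.n * D.n + 10 ≤ W) (hn : σ.reg .n = D.n) (hoff : σ.reg .off = D.off)
    (hTnn : σ.reg .Tnn = D.T * D.n * D.n) (hρ : D.T * D.n * D.n ≤ ρ .Tnn) :
    Cmd.Spec W ρ countCmd σ fun τ => τ.reg .tot = D.edgeCount := by
  rw [countCmd]
  simp only [Cmd.spec_seq, Cmd.spec_assign, ok_ofNat, eval_ofNat]
  refine ⟨by omega, ?_⟩
  set p : ℕ → Prop := fun j => j / D.n % D.n + 1 ≤ j % D.n ∧ 1 ≤ D.a j with hp
  have eT : (σ.setReg .tot 0).reg .Tnn = D.T * D.n * D.n := by simp [hTnn]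
  refine Cmd.Spec.weaken (Cmd.Spec.forLoop (fun m τ => τ.reg .tot = #{j ∈ range m | p j})
    (by decide) (by decide) (by decide) ?_ ?_ ?_) ?_
  · rwa [eT]
  · simp
  · intro j hj τ hτj hτ hτm hI
    have hτm := hτm (by simp [Cmd.KeepsMem])
    rw [eT] at hj
    have en : τ.reg .n = D.n := by rw [hτ _ (by decide) (by decide)]; simp [hn]
    have eo : τ.reg .off = D.off := by rw [hτ _ (by decide) (by decide)]; simp [hoff]
    have em : τ.mem (D.off + j) = D.a j := by rw [hτm]; exact hσ.a j
    have hpos : 0 < D.n := Nat.pos_of_ne_zero fun h => by simp [h] at hj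
    have h₂ : j % D.n < D.n := Nat.mod_lt _ hpos
    have h₃ : j / D.n % D.n ≤ j := (Nat.mod_le _ _).trans (Nat.div_le_self _ _)
    have hc : #{j ∈ range j | p j} ≤ j := by
      simpa using card_filter_le (range j) p
    have hcp : p j → #{j ∈ range (j + 1) | p j} = #{j ∈ range j | p j} + 1 := fun h => by
      rw [range_add_one, filter_insert, if_pos h, card_insert_of_notMem (by simp)]
    have hcn : ¬ p j → #{j ∈ range (j + 1) | p j} = #{j ∈ range j | p j} := fun h => by
      rw [range_add_one, filter_insert, if_neg h]
    simp only [Cmd.spec_ite, Cmd.spec_assign, Cmd.spec_skip, ok_ofNat, ok_mem, ok_add, ok_div,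
      ok_mod, ok_var, eval_ofNat, eval_mem, eval_add, eval_div, eval_mod, eval_var, hτj, en, eo,
      em, true_and, State.setReg_reg_self, ne_eq, reduceCtorEq, not_false_eq_true,
      State.setReg_reg_of_ne, hI, and_self]
    refine ⟨by omega, fun h₆ => ⟨by omega, by omega, fun h₇ => ⟨by omega, ?_⟩, fun h₇ => ?_⟩,
      fun h₆ => ?_⟩
    · exact (hcp ⟨h₆, h₇⟩).symm
    · exact (hcn fun h => by have := h.2; omega).symm
    · exact (hcn fun h => by have := h.1; omega).symm
  · intro τ _ _ hI
    rw [eT] at hI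
    exact hI

theorem spec_constCmd {ρ : Var → ℕ} (hσ : D.Input σ.mem) (hT : 0 < D.T)
    (hW : D.room ≤ W) (h₁ : σ.reg .n = D.n) (h₂ : σ.reg .T = D.T) (h₃ : σ.reg .k = D.k)
    (h₄ : σ.reg .ℓ = D.ℓ) (h₅ : σ.reg .off = D.off) (h₆ : σ.reg .Tn = D.T * D.n)
    (h₇ : σ.reg .Tnn = D.T * D.n * D.n) : Cmd.Spec W ρ constCmd σ D.Ready := by
  unfold room at hW
  have hnn : D.n * D.n ≤ D.T * D.n * D.n := by
    rw [Nat.mul_assoc]; exact Nat.le_mul_of_pos_left _ hT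
  have hL : D.ℓ + 2 = D.L := rfl
  have hS : D.k * D.L + 1 = D.S := rfl
  have hE : D.T * D.n * D.n + 1 = D.E := rfl
  simp only [constCmd, Cmd.spec_seq, Cmd.spec_assign, ok_ofNat, ok_var, ok_mul, ok_add, eval_ofNat,
    eval_var, eval_mul, eval_add, true_and, State.setReg_reg_self, ne_eq, reduceCtorEq,
    not_false_eq_true, State.setReg_reg_of_ne, h₁, h₂, h₃, h₄, h₅, h₆, h₇, hL, hS, hE]
  refine ⟨by omega, by omega, ⟨by omega, by omega, by omega⟩, by omega, by omega, by omega, ?_⟩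
  constructor <;> simp [h₁, h₂, h₃, h₄, h₅, h₆, h₇, hσ.a]

open Classical in
/-- The answer of the program if `t` edges are to be covered. -/
def Accepts (D : TimelineDP) (t : ℕ) : Prop :=
  if D.T * D.n * D.n = 0 then t = 0
  else ∃ x < D.N, D.T * D.N + x ∈ D.marks (D.T * D.N * D.N) ∧ t ≤ x % D.E

-- The word size `room` matters only after the test for `T * n * n = 0`, hence the conditional
-- hypothesis `hW'`.
open Classical in
theorem spec_program (hσ : D.Input σ.mem) (hans : σ.reg .ans = 0)
    (hW : D.off + D.T * D.n * D.n + 10 ≤ W) (hW' : D.T * D.n * D.n ≠ 0 → D.room ≤ W)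
    {t : Expr Var} {t₀ : ℕ} (ht : ∀ τ : State Var, τ.mem = σ.mem → τ.reg .tot = D.edgeCount →
      t.Ok W τ ∧ t.eval τ = t₀) :
    Cmd.Spec W D.loopBound (program D.off t) σ fun τ =>
      τ.reg .ans = if D.Accepts t₀ then 1 else 0 := by
  rw [program, Cmd.spec_seq]
  refine (spec_readCmd hσ hans hW).weaken fun τ _ _ h => ?_
  obtain ⟨em, eans, en, eT, ek, eℓ, eo, eTn, eTnn⟩ := h
  rw [Cmd.spec_seq]
  refine (spec_countCmd (by rwa [em]) hW en eo eTnn ?_).weaken fun ν hν hνm hc => ?_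
  · by_cases h : D.T * D.n * D.n = 0
    · simp [h]
    · simp [loopBound, h, rounds]
  replace hνm : ν.mem = σ.mem := (hνm (by simp [countCmd, Cmd.KeepsMem])).trans em
  obtain ⟨hok, hev⟩ := ht ν hνm hc
  have hν' : ∀ z, z ≠ .tot → z ≠ .j → ν.reg z = τ.reg z := fun z h₁ h₂ =>
    hν z (by simp [countCmd, Cmd.writes, h₁, h₂])
  simp only [Cmd.spec_seq, Cmd.spec_assign, Cmd.spec_ite (a := val .Tnn),
    Cmd.spec_ite (a := val .t), Cmd.spec_skip, ok_var, ok_ofNat,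
    eval_ofNat, eval_var, true_and, hok, hev, ne_eq, reduceCtorEq, not_false_eq_true,
    State.setReg_reg_of_ne, State.setReg_reg_self, hν', eTnn, eans]
  refine ⟨by omega, fun h => ⟨by omega, fun h' => ⟨by omega, ?_⟩, fun h' => ?_⟩, fun h => ?_⟩
  · rw [if_pos]; rw [Accepts, if_pos (by omega)]; omega
  · rw [if_neg]; rw [Accepts, if_pos (by omega)]; omega
  have hT : 0 < D.T := Nat.pos_of_ne_zero fun e => by simp [e] at h
  have hn : 0 < D.n := Nat.pos_of_ne_zero fun e => by simp [e] at h
  replace hW' := hW' h.ne'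
  have hρ : ∀ z, D.rounds z ≤ D.loopBound z := fun z => by rw [loopBound, if_neg h.ne']
  refine (spec_constCmd (D := D) (by simpa [hνm] using hσ) hT hW' ?_ ?_ ?_ ?_ ?_ ?_
    ?_).weaken fun θ hθ hθm hR => ?_
  iterate 7 simp [hν', en, eT, ek, eℓ, eo, eTn, eTnn]
  replace hθm : θ.mem = σ.mem :=
    (hθm (by simp [constCmd, Cmd.KeepsMem])).trans hνm
  refine (spec_maxCmd hR hW' hT hn (hρ .Tn) (hρ .n) (hρ .T)).weaken fun φ hφ hφm hP => ?_
  replace hφm : φ.mem = σ.mem :=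
    (hφm (by simp [maxCmd, baseCmd, Cmd.KeepsMem])).trans hθm
  have hR' : D.Ready φ := hR.congr (fun z hz => hφ z (by revert z; decide)) fun j _ => by
    rw [hφm, hθm]
  refine (spec_tableCmd hR' hW' hT (hρ .Tn) (hρ .n) (hρ .nn) (hρ .TNN) hP fun z => ?_).weaken
    fun ψ hψ _ h₁ => ?_
  -- All cells behind the input are `0`, so the table is empty without any initialisation.
  · rw [hφm, Nat.add_assoc, Nat.add_assoc, hσ.a, hσ.a_eq_zero _ (by omega)]
    simp
  obtain ⟨hR₁, hTb, hN⟩ := h₁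
  have et : ψ.reg .t = t₀ := by
    rw [hψ _ (by decide), hφ _ (by decide), hθ _ (by decide)]; simp
  have h₂ := spec_searchCmd (ρ := D.loopBound) hR₁ hW' hT (hρ .N) hN hTb
  rw [et] at h₂
  refine h₂.weaken fun χ _ _ h₃ => h₃.trans ?_
  congr 1
  exact propext (by rw [Accepts, if_neg h.ne'])

end TimelineDP

/-! ## The table and sequences of digits -/

namespace TimelineDP

open Finset

variable {D : TimelineDP}

theorem one_le_N : 1 ≤ D.N := Nat.mul_pos (Nat.le_add_left _ _ : 1 ≤ D.E) (le_sup_right : 1 ≤ D.P)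

/-- The entries in the layers of the table that are reached by transitions. -/
inductive Reach (D : TimelineDP) : ℕ → ℕ → Prop
  | zero : Reach D 0 0
  | step {i x y : ℕ} (h : Reach D i x) (hy : y < D.N) (hs : D.Step i x y) : Reach D (i + 1) y

theorem Reach.lt {i x : ℕ} (h : D.Reach i x) : x < D.N := by
  cases h with
  | zero => exact D.one_le_N
  | step _ hy _ => exact hy

/-- Soundness of the table: an address `z` stands for entry `z % N` of layer `z / N`, and each new
mark comes with a marked source one layer below. -/
theorem reach_of_mem_marks {J z : ℕ} (h : z ∈ D.marks J) : D.Reach (z / D.N) (z % D.N) := by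
  induction J generalizing z with
  | zero =>
    obtain rfl : z = 0 := h
    simpa using Reach.zero
  | succ J ih =>
    obtain h | ⟨rfl, hJ, hs⟩ := h
    · exact ih h
    · have hlt : J % D.N < D.N := Nat.mod_lt _ D.one_le_N
      have h₁ : ((J / (D.N * D.N) + 1) * D.N + J % D.N) / D.N = J / (D.N * D.N) + 1 := by
        rw [Nat.add_comm, Nat.add_mul_div_right _ _ D.one_le_N, Nat.div_eq_of_lt hlt, Nat.zero_add]
      have h₂ : ((J / (D.N * D.N) + 1) * D.N + J % D.N) % D.N = J % D.N := by
        rw [Nat.add_comm, Nat.add_mul_mod_self_right, Nat.mod_mod]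
      rw [h₁, h₂]
      have h₃ := ih hJ
      rw [Nat.div_div_eq_div_mul] at h₃
      exact .step h₃ hlt hs

theorem marks_mono {J J' : ℕ} (h : J ≤ J') : D.marks J ⊆ D.marks J' :=
  monotone_nat_of_le_succ (f := D.marks) (fun _ _ hz => Or.inl hz) h

/-- Completeness of the table: rounds are ordered lexicographically by layer, source and target, so
layer `i` is finished before round `i * N * N`, where the transitions out of it begin. -/
theorem Reach.mem_marks {i x : ℕ} (h : D.Reach i x) : i * D.N + x ∈ D.marks (i * D.N * D.N) := by
  induction h with
  | zero => simp [marks]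
  | @step i x y h hy hs ih =>
    have hN := D.one_le_N
    have hx := h.lt
    have e₁ : ((i * D.N + x) * D.N + y) / D.N = i * D.N + x := by
      rw [Nat.add_comm, Nat.add_mul_div_right _ _ hN, Nat.div_eq_of_lt hy, Nat.zero_add]
    have e₂ : (i * D.N + x) / D.N = i := by
      rw [Nat.add_comm, Nat.add_mul_div_right _ _ hN, Nat.div_eq_of_lt hx, Nat.zero_add]
    have e₃ : ((i * D.N + x) * D.N + y) % D.N = y := by
      rw [Nat.add_comm, Nat.add_mul_mod_self_right, Nat.mod_eq_of_lt hy]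
    have e₄ : (i * D.N + x) % D.N = x := by
      rw [Nat.add_comm, Nat.add_mul_mod_self_right, Nat.mod_eq_of_lt hx]
    have hle : (i * D.N + x) * D.N + y + 1 ≤ (i + 1) * D.N * D.N := by
      have : (i * D.N + x + 1) * D.N ≤ (i + 1) * D.N * D.N :=
        Nat.mul_le_mul_right _ (by rw [Nat.add_mul i]; omega)
      rw [Nat.add_mul (_ + _)] at this
      omega
    refine marks_mono hle (Or.inr ⟨?_, ?_, ?_⟩)
    · rw [← Nat.div_div_eq_div_mul, e₁, e₂, e₃]
    · rw [e₁]
      exact marks_mono (by rw [Nat.add_mul]; omega) ih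
    · rwa [← Nat.div_div_eq_div_mul, e₁, e₂, e₃, e₄]

theorem exists_marks_iff {t : ℕ} :
    (∃ x < D.N, D.T * D.N + x ∈ D.marks (D.T * D.N * D.N) ∧ t ≤ x % D.E) ↔
      ∃ x, D.Reach D.T x ∧ t ≤ x % D.E := by
  constructor
  · rintro ⟨x, hx, h, ht⟩
    have h := reach_of_mem_marks h
    rw [Nat.add_comm, Nat.add_mul_div_right _ _ D.one_le_N, Nat.div_eq_of_lt hx, Nat.zero_add,
      Nat.add_mul_mod_self_right, Nat.mod_eq_of_lt hx] at h
    exact ⟨x, h, ht⟩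
  · rintro ⟨x, h, ht⟩
    exact ⟨x, h.lt, h.mem_marks, ht⟩

theorem Reach.exists_path {i x : ℕ} (h : D.Reach i x) :
    ∃ X : ℕ → ℕ, X i = x ∧ X 0 = 0 ∧ ∀ j < i, D.Step j (X j) (X (j + 1)) := by
  induction h with
  | zero => exact ⟨fun _ => 0, rfl, rfl, fun j hj => absurd hj (by omega)⟩
  | @step i x y h hy hs ih =>
    obtain ⟨X, hX, h0, hX'⟩ := ih
    refine ⟨Function.update X (i + 1) y, by simp, by simp [h0], fun j hj => ?_⟩
    rcases Nat.lt_succ_iff_lt_or_eq.1 hj with hj | rfl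
    · rw [Function.update_of_ne (by omega), Function.update_of_ne (by omega)]
      exact hX' j hj
    · rw [Function.update_of_ne (by omega), Function.update_self, hX]
      exact hs

/-- Existence of mixed radix representations, by adding the top digit. It does not disturb a lower
digit because its place value is a multiple of the next place value above that digit. -/
theorem exists_code {q m : ℕ} {c : ℕ → ℕ} (hc : ∀ v < m, c v < D.base q v) :
    ∃ X < ∏ u ∈ range m, D.base q u, ∀ v < m, D.digit q X v = c v := by
  induction m with
  | zero => exact ⟨0, by simp, fun v hv => absurd hv (by omega)⟩
  | succ m ih =>
    obtain ⟨X, hX, hd⟩ := ih fun v hv => hc v (by omega)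
    have hpos : ∀ l, 0 < ∏ u ∈ range l, D.base q u := fun l =>
      Finset.prod_pos fun u _ => D.one_le_base q u
    refine ⟨X + (∏ u ∈ range m, D.base q u) * c m, ?_, fun v hv => ?_⟩
    · have h₁ := hc m (by omega)
      calc X + (∏ u ∈ range m, D.base q u) * c m
          < (∏ u ∈ range m, D.base q u) * (c m + 1) := by rw [Nat.mul_succ]; omega
        _ ≤ _ := by rw [prod_range_succ]; exact Nat.mul_le_mul_left _ h₁
    · rcases Nat.lt_succ_iff_lt_or_eq.1 hv with hv | rfl
      · rw [← hd v hv, digit, digit]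
        have h₁ : (∏ u ∈ range (v + 1), D.base q u) ∣ ∏ u ∈ range m, D.base q u :=
          prod_dvd_prod_of_subset _ _ _ (range_subset_range.2 hv)
        obtain ⟨R, hR⟩ := h₁
        rw [hR, prod_range_succ, Nat.mul_assoc, Nat.mul_assoc, Nat.add_mul_div_left _ _ (hpos v),
          Nat.add_mul_mod_self_left]
      · rw [digit, Nat.add_mul_div_left _ _ (hpos v), Nat.div_eq_of_lt hX, Nat.zero_add,
          Nat.mod_eq_of_lt (hc v (by omega))]

/-- The number of edges at time `i` that have an endpoint `v` for which `e v` is the digit of an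
active vertex. -/
def digitGain (D : TimelineDP) (i : ℕ) (e : ℕ → ℕ) : ℕ :=
  #{j ∈ range (D.n * D.n) | j / D.n + 1 ≤ j % D.n ∧ 1 ≤ D.a (i * (D.n * D.n) + j) ∧
    1 ≤ e (j / D.n) % D.L + e (j % D.n) % D.L}

theorem digitGain_congr {i : ℕ} {e e' : ℕ → ℕ} (h : ∀ v < D.n, e v = e' v) :
    D.digitGain i e = D.digitGain i e' := by
  unfold digitGain
  congr 1
  refine filter_congr fun j hj => ?_
  rw [mem_range] at hj
  rw [h _ (Nat.div_lt_of_lt_mul hj), h _ (Nat.mod_lt _ (Nat.pos_of_ne_zero fun e => by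
    simp [e] at hj))]

theorem gain_eq (i Y : ℕ) : D.gain i Y = D.digitGain i (D.digit (i + 1) Y) := by
  unfold gain digitGain
  congr 1

theorem base_zero (v : ℕ) : D.base 0 v = 1 := if_neg fun h => by
  obtain ⟨⟨j, -, -, hj⟩, -⟩ := h
  exact Nat.not_succ_le_zero _ hj

open Classical in
/-- A sequence of digits for every vertex, in which all transitions are possible. -/
structure Run (D : TimelineDP) (d : ℕ → ℕ → ℕ) : Prop where
  lt : ∀ q v, d q v < D.base q v
  succ_le : ∀ i < D.T, ∀ v < D.n,
    D.succDigit (if D.Bag (i + 1) v then d i v else 0) ≤ d (i + 1) v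

/-- The number of covered edges stays below `E`, so it never spills into the code when both are
packed into one entry. -/
theorem sum_digitGain_lt (d : ℕ → ℕ → ℕ) {i : ℕ} (hi : i ≤ D.T) :
    ∑ j ∈ range i, D.digitGain j (d (j + 1)) < D.E := by
  have h : ∑ j ∈ range i, D.digitGain j (d (j + 1)) ≤ i * (D.n * D.n) := by
    have := sum_le_card_nsmul (range i) (fun j => D.digitGain j (d (j + 1))) (D.n * D.n)
      fun j _ => (card_filter_le _ _).trans (by simp)
    simpa using this
  have h' : i * (D.n * D.n) ≤ D.T * D.n * D.n := by
    rw [Nat.mul_assoc]; exact Nat.mul_le_mul_right _ hi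
  exact Nat.lt_succ_of_le (h.trans h')

/-- The entries built here carry the exact count of covered edges, although `Step` would tolerate a
smaller one. -/
theorem Run.exists_reach {d : ℕ → ℕ → ℕ} (hd : D.Run d) : ∀ i ≤ D.T, ∃ x, D.Reach i x ∧
    (∀ v < D.n, D.digit i (x / D.E) v = d i v) ∧
    x % D.E = ∑ j ∈ range i, D.digitGain j (d (j + 1)) := by
  intro i
  have hE : 0 < D.E := Nat.succ_pos _
  induction i with
  | zero =>
    refine fun _ => ⟨0, .zero, fun v _ => ?_, by simp⟩
    have h₁ := hd.lt 0 v
    have h₂ := digit_lt (D := D) 0 (0 / D.E) v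
    rw [base_zero] at h₁ h₂
    omega
  | succ i ih =>
    intro hi
    obtain ⟨x, hx, hdig, hcnt⟩ := ih (by omega)
    obtain ⟨Y, hY, hYd⟩ := exists_code (D := D) (q := i + 1) (m := D.n) (c := d (i + 1))
      fun v _ => hd.lt _ v
    have hlt := sum_digitGain_lt (D := D) d hi
    set s := ∑ j ∈ range (i + 1), D.digitGain j (d (j + 1)) with hs
    have e₁ : (s + D.E * Y) / D.E = Y := by
      rw [Nat.add_mul_div_left _ _ hE, Nat.div_eq_of_lt hlt, Nat.zero_add]
    have e₂ : (s + D.E * Y) % D.E = s := by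
      rw [Nat.add_mul_mod_self_left, Nat.mod_eq_of_lt hlt]
    refine ⟨s + D.E * Y, .step hx ?_ ⟨fun v hv => ?_, ?_⟩, ?_, e₂⟩
    · have h₁ : Y + 1 ≤ D.P := hY.trans_le (prod_base_le_P hi)
      have h₂ : D.E * (Y + 1) ≤ D.N := Nat.mul_le_mul_left _ h₁
      rw [Nat.mul_succ] at h₂
      omega
    · rw [e₁, hYd v hv, kept, hdig v hv]
      exact hd.succ_le i (by omega) v hv
    · rw [e₁, e₂, hcnt, gain_eq, digitGain_congr hYd, hs, sum_range_succ]
    · rwa [e₁]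

/-- A path of entries decodes to a run. `Step` bounds the growth of the count by the gain, so the
final count is at most the sum of the gains. An inequality suffices there because only a lower
threshold is asked for. -/
theorem exists_reach_iff {t : ℕ} : (∃ x, D.Reach D.T x ∧ t ≤ x % D.E) ↔
    ∃ d, D.Run d ∧ t ≤ ∑ i ∈ range D.T, D.digitGain i (d (i + 1)) := by
  constructor
  · rintro ⟨x, hx, ht⟩
    obtain ⟨X, rfl, h0, hX⟩ := hx.exists_path
    refine ⟨fun q => D.digit q (X q / D.E), ⟨fun q v => digit_lt _ _ _, fun i hi v hv =>
      (hX i hi).1 v hv⟩, ht.trans ?_⟩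
    have key : ∀ i ≤ D.T, X i % D.E ≤
        ∑ j ∈ range i, D.digitGain j (D.digit (j + 1) (X (j + 1) / D.E)) := by
      intro i
      induction i with
      | zero => simp [h0]
      | succ i ih =>
        intro hi
        have h₁ := (hX i (by omega)).2
        have h₂ := ih (by omega)
        rw [gain_eq] at h₁
        rw [sum_range_succ]
        omega
    exact key _ le_rfl
  · rintro ⟨d, hd, ht⟩
    obtain ⟨x, hx, -, hcnt⟩ := hd.exists_reach D.T le_rfl
    exact ⟨x, hx, by rwa [hcnt]⟩

end TimelineDP

/-! ## The encoding of the instances -/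

theorem List.length_flatMap_of_length_eq {α β : Type*} {m : ℕ} {f : α → List β} :
    ∀ {l : List α}, (∀ x ∈ l, (f x).length = m) → (l.flatMap f).length = l.length * m
  | [], _ => by simp
  | x :: l, h => by
    rw [List.flatMap_cons, List.length_append, h x (by simp), List.length_cons, Nat.succ_mul,
      List.length_flatMap_of_length_eq fun y hy => h y (by simp [hy]), Nat.add_comm]

theorem List.getD_flatMap_of_length_eq {α β : Type*} {m : ℕ} {f : α → List β} {b : β} {j : ℕ}
    (hj : j < m) : ∀ {l : List α} {i : ℕ} (hi : i < l.length), (∀ x ∈ l, (f x).length = m) →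
      (l.flatMap f).getD (i * m + j) b = (f l[i]).getD j b
  | x :: l, 0, _, h => by
    rw [List.flatMap_cons, List.getD_append _ _ _ _ (by rw [h x (by simp)]; omega)]
    simp
  | x :: l, i + 1, hi, h => by
    rw [List.flatMap_cons, List.getD_append_right _ _ _ _
      (by rw [h x (by simp), Nat.succ_mul]; omega), h x (by simp),
      show (i + 1) * m + j - m = i * m + j by rw [Nat.succ_mul]; omega,
      List.getD_flatMap_of_length_eq hj (Nat.lt_of_succ_lt_succ hi) fun y hy => h y (by simp [hy])]
    rfl

namespace TemporalGraph

variable {n T : ℕ} (G : TemporalGraph (Fin n) T)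

theorem length_encode : G.encode.length = T * n * n := by
  rw [encode, List.length_flatMap_of_length_eq (m := n * n), List.length_finRange, Nat.mul_assoc]
  intro i _
  rw [List.length_flatMap_of_length_eq (m := n), List.length_finRange]
  simp

open Classical in
theorem getD_encode (i : Fin T) (u v : Fin n) :
    G.encode.getD ((i * n + u) * n + v) 0 = if (G i).Adj u v then 1 else 0 := by
  have h : (u : ℕ) * n + v < n * n := by
    have : ((u : ℕ) + 1) * n ≤ n * n := Nat.mul_le_mul_right _ u.2
    rw [Nat.add_mul] at this
    omega
  rw [encode, show ((i : ℕ) * n + u) * n + v = i * (n * n) + (u * n + v) by ring,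
    List.getD_flatMap_of_length_eq h (i := i) (by simp),
    List.getD_flatMap_of_length_eq v.2 (i := u) (by simp)]
  · simp [List.getD_eq_getElem?_getD]
  · simp
  · intro i _
    rw [List.length_flatMap_of_length_eq (m := n), List.length_finRange]
    simp

end TemporalGraph

open TimelineDP Finset

/-- The dynamic program for an instance whose adjacency matrices start at address `off`. -/
noncomputable def TVCInstance.dp (I : TVCInstance) (off : ℕ) : TimelineDP where
  n := I.n
  T := I.T
  k := min I.k I.T
  ℓ := min I.ℓ I.T
  off := off
  a := fun j => I.G.encode.getD j 0

namespace TVCInstance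

variable {I : TVCInstance} {off : ℕ}

theorem a_dp (i : Fin I.T) (u v : Fin I.n) :
    1 ≤ (I.dp off).a ((i * I.n + u) * I.n + v) ↔ (I.G i).Adj u v := by
  classical
  change 1 ≤ I.G.encode.getD _ 0 ↔ _
  rw [I.G.getD_encode i u v]
  split_ifs with h <;> simp [h]

/-- The index `j = p * n + u` packs a time `p` and a neighbour `u`. The predicate `q` on times is
arbitrary so that both halves of `Bag` are covered. -/
theorem incident_dp (v : Fin I.n) (q : ℕ → Prop) :
    (∃ j < I.T * I.n, (I.dp off).Incident v j ∧ q (j / I.n)) ↔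
      ∃ p : Fin I.T, 1 ≤ I.G.deg p v ∧ q p := by
  have hn : 0 < I.n := v.pos
  constructor
  · rintro ⟨j, hj, hinc, hq⟩
    have hp : j / I.n < I.T := Nat.div_lt_of_lt_mul (by rwa [Nat.mul_comm])
    refine ⟨⟨j / I.n, hp⟩, ?_, hq⟩
    have hadj := (I.a_dp (off := off) ⟨j / I.n, hp⟩ v ⟨j % I.n, Nat.mod_lt _ hn⟩).1 hinc
    rw [TemporalGraph.deg, Nat.one_le_iff_ne_zero, ne_eq, Set.ncard_eq_zero]
    exact Set.Nonempty.ne_empty ⟨_, hadj⟩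
  · rintro ⟨p, hdeg, hq⟩
    rw [TemporalGraph.deg, Nat.one_le_iff_ne_zero, ne_eq, Set.ncard_eq_zero,
      ← ne_eq, ← Set.nonempty_iff_ne_empty] at hdeg
    obtain ⟨u, hu⟩ := hdeg
    have e₁ : ((p : ℕ) * I.n + u) / I.n = p := by
      rw [Nat.add_comm, Nat.add_mul_div_right _ _ hn, Nat.div_eq_of_lt u.2, Nat.zero_add]
    have e₂ : ((p : ℕ) * I.n + u) % I.n = u := by
      rw [Nat.add_comm, Nat.add_mul_mod_self_right, Nat.mod_eq_of_lt u.2]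
    refine ⟨p * I.n + u, ?_, ?_, by rwa [e₁]⟩
    · have : ((p : ℕ) + 1) * I.n ≤ I.T * I.n := Nat.mul_le_mul_right _ p.2
      rw [Nat.add_mul] at this
      have := u.2
      omega
    · change 1 ≤ (I.dp off).a ((((p : ℕ) * I.n + u) / I.n * I.n + v) * I.n +
        ((p : ℕ) * I.n + u) % I.n)
      rw [e₁, e₂]
      exact (I.a_dp p v u).2 hu

theorem bag_dp (i : Fin I.T) (v : Fin I.n) : (I.dp off).Bag (i + 1) v ↔ v ∈ I.G.bag i := by
  have h₁ := I.incident_dp (off := off) v fun p => p + 1 ≤ (i : ℕ) + 1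
  have h₂ := I.incident_dp (off := off) v fun p => (i : ℕ) + 1 ≤ p + 1
  refine (and_congr h₁ h₂).trans ?_
  simp only [TemporalGraph.bag, Set.mem_ofPred_eq, Nat.add_le_add_iff_right, Fin.val_fin_le]
  constructor
  · rintro ⟨⟨p, hp, hpi⟩, q, hq, hqi⟩
    exact ⟨p, q, hpi, hqi, hp, hq⟩
  · rintro ⟨p, q, hpi, hqi, hp, hq⟩
    exact ⟨⟨p, hp, hpi⟩, q, hq, hqi⟩

theorem bag_dp_of_adj {i : Fin I.T} {u v : Fin I.n} (h : (I.G i).Adj u v) :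
    (I.dp off).Bag (i + 1) u := by
  have hdeg : 1 ≤ I.G.deg i u := by
    rw [TemporalGraph.deg, Nat.one_le_iff_ne_zero, ne_eq, Set.ncard_eq_zero]
    exact Set.Nonempty.ne_empty ⟨v, h⟩
  exact (I.bag_dp i u).2 ⟨i, i, le_rfl, le_rfl, hdeg, hdeg⟩

/-- Only members of the bag contribute a factor `S`; all other bases are `1`. This is where the
width becomes an exponent. -/
theorem P_dp_le : (I.dp off).P ≤ (I.dp off).S ^ I.G.vimw := by
  classical
  have hS := (I.dp off).one_le_S
  refine sup_le (Finset.sup_le fun i hi => ?_) (Nat.one_le_pow _ _ hS)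
  replace hi : i < I.T := mem_range.1 hi
  have h₁ : ∏ v ∈ range (I.dp off).n, (I.dp off).base (i + 1) v =
      (I.dp off).S ^ (I.G.bag ⟨i, hi⟩).ncard := by
    have h₂ : (I.G.bag ⟨i, hi⟩).ncard = #{v | v ∈ I.G.bag ⟨i, hi⟩} := by
      rw [← Set.ncard_coe_finset]
      congr 1
      ext; simp
    rw [h₂, ← prod_const, prod_filter]
    exact (Fin.prod_univ_eq_prod_range (fun v => (I.dp off).base (i + 1) v) I.n).symm.trans
      (prod_congr rfl fun v _ => if_congr (I.bag_dp ⟨i, hi⟩ v) rfl rfl)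
  rw [h₁]
  exact Nat.pow_le_pow_right hS
    (Finset.le_sup (f := fun i : Fin I.T => (I.G.bag i).ncard) (mem_univ _))

theorem index_lt {n T m : ℕ} (h : m < T * n * n) :
    m / (n * n) < T ∧ m / n % n < n ∧ m % n < n ∧ (m / (n * n) * n + m / n % n) * n + m % n = m := by
  have hn : 0 < n := Nat.pos_of_ne_zero fun e => by simp [e] at h
  refine ⟨Nat.div_lt_of_lt_mul (by rwa [Nat.mul_comm, ← Nat.mul_assoc]), Nat.mod_lt _ hn,
    Nat.mod_lt _ hn, ?_⟩
  rw [← Nat.div_div_eq_div_mul, Nat.div_add_mod', Nat.div_add_mod']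

theorem index_eq {n T : ℕ} (i : Fin T) (u v : Fin n) : ((i * n + u) * n + v) / (n * n) = i ∧
    ((i * n + u) * n + v) / n % n = u ∧ ((i * n + u) * n + v) % n = (v : ℕ) ∧
    ((i * n + u) * n + v : ℕ) < T * n * n := by
  have hn : 0 < n := v.pos
  have e₁ : ((i * n + u) * n + v : ℕ) / n = i * n + u := by
    rw [Nat.add_comm, Nat.add_mul_div_right _ _ hn, Nat.div_eq_of_lt v.2, Nat.zero_add]
  have e₂ : ((i : ℕ) * n + u) / n = i := by
    rw [Nat.add_comm, Nat.add_mul_div_right _ _ hn, Nat.div_eq_of_lt u.2, Nat.zero_add]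
  refine ⟨by rw [← Nat.div_div_eq_div_mul, e₁, e₂], ?_, ?_, ?_⟩
  · rw [e₁, Nat.add_comm, Nat.add_mul_mod_self_right, Nat.mod_eq_of_lt u.2]
  · rw [Nat.add_comm, Nat.add_mul_mod_self_right, Nat.mod_eq_of_lt v.2]
  · have h₁ : ((i : ℕ) + 1) * n ≤ T * n := Nat.mul_le_mul_right _ i.2
    have h₂ : ((i : ℕ) * n + u + 1) * n ≤ T * n * n :=
      Nat.mul_le_mul_right _ (by rw [Nat.add_mul] at h₁; omega)
    rw [Nat.add_mul (_ + _)] at h₂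
    omega

/-- The number of temporal edges with an endpoint `v` for which `act i v` holds at its time. -/
theorem ncard_temporalEdges (act : ℕ → ℕ → Prop) [∀ i v, Decidable (act i v)] :
    {e ∈ I.G.temporalEdges | ∃ v ∈ e.1, act e.2 v}.ncard =
      #{m ∈ range (I.T * I.n * I.n) | m / I.n % I.n + 1 ≤ m % I.n ∧ 1 ≤ (I.dp off).a m ∧
        (act (m / (I.n * I.n)) (m / I.n % I.n) ∨ act (m / (I.n * I.n)) (m % I.n))} := by
  rw [← Set.ncard_coe_finset]
  symm
  have hlt : ∀ m ∈ ((range (I.T * I.n * I.n)).filter fun m => m / I.n % I.n + 1 ≤ m % I.n ∧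
      1 ≤ (I.dp off).a m ∧ (act (m / (I.n * I.n)) (m / I.n % I.n) ∨
      act (m / (I.n * I.n)) (m % I.n)) : Set ℕ), m < I.T * I.n * I.n := fun m hm => by
    simpa using (mem_filter.1 (mem_coe.1 hm)).1
  -- An index `m` above the diagonal is sent to the edge of its row and column at its time step.
  refine Set.ncard_congr (fun m hm => (s(⟨m / I.n % I.n, (index_lt (hlt m hm)).2.1⟩,
    ⟨m % I.n, (index_lt (hlt m hm)).2.2.1⟩), ⟨m / (I.n * I.n), (index_lt (hlt m hm)).1⟩))
    (fun m hm => ?_) (fun m m' hm hm' h => ?_) fun e he => ?_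
  · have hm' := (mem_filter.1 (mem_coe.1 hm)).2
    have hadj := hm'.2.1
    rw [← (index_lt (hlt m hm)).2.2.2] at hadj
    refine ⟨(I.a_dp (off := off) ⟨_, (index_lt (hlt m hm)).1⟩ ⟨_, (index_lt (hlt m hm)).2.1⟩
      ⟨_, (index_lt (hlt m hm)).2.2.1⟩).1 hadj, ?_⟩
    rcases hm'.2.2 with h | h
    · exact ⟨_, Sym2.mem_mk_left _ _, h⟩
    · exact ⟨_, Sym2.mem_mk_right _ _, h⟩
  · have h₁ := (mem_filter.1 (mem_coe.1 hm)).2.1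
    have h₂ := (mem_filter.1 (mem_coe.1 hm')).2.1
    simp only [Prod.mk.injEq, Sym2.eq_iff, Fin.mk.injEq] at h
    obtain ⟨⟨h₃, h₄⟩ | ⟨h₃, h₄⟩, h₅⟩ := h
    · rw [← (index_lt (hlt m hm)).2.2.2, ← (index_lt (hlt m' hm')).2.2.2, h₃, h₄, h₅]
    -- Swapped endpoints would contradict that the row index is smaller than the column index in
    -- both cases.
    · omega
  · obtain ⟨e, i⟩ := e
    have key : ∀ u v : Fin I.n, u < v → (I.G i).Adj u v → act i u ∨ act i v → ∃ m hm,
        ((s(⟨m / I.n % I.n, (index_lt (hlt m hm)).2.1⟩,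
          ⟨m % I.n, (index_lt (hlt m hm)).2.2.1⟩) : Sym2 (Fin I.n)),
          (⟨m / (I.n * I.n), (index_lt (hlt m hm)).1⟩ : Fin I.T)) = (s(u, v), i) := by
      intro u v huv hadj hact
      obtain ⟨e₁, e₂, e₃, e₄⟩ := index_eq i u v
      refine ⟨(i * I.n + u) * I.n + v, mem_coe.2 (mem_filter.2 ⟨mem_range.2 e₄, ?_, ?_, ?_⟩), ?_⟩
      · rw [e₂, e₃]; exact huv
      · exact (I.a_dp i u v).2 hadj
      · rwa [e₁, e₂, e₃]
      · simp only [e₁, e₂, e₃, Fin.eta]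
    obtain ⟨hadj, w, hw, hact⟩ := he
    induction e with | _ u v
    rw [TemporalGraph.temporalEdges, Set.mem_ofPred_eq, SimpleGraph.mem_edgeSet] at hadj
    have hact : act i u ∨ act i v := by
      rcases Sym2.mem_iff.1 hw with rfl | rfl
      exacts [Or.inl hact, Or.inr hact]
    rcases lt_or_gt_of_ne hadj.ne with h | h
    · exact key u v h hadj hact
    · rw [Sym2.eq_swap]
      exact key v u h hadj.symm hact.symm

theorem card_filter_range_mul (p : ℕ → Prop) [DecidablePred p] (K T : ℕ) :
    #{m ∈ range (T * K) | p m} = ∑ i ∈ range T, #{j ∈ range K | p (i * K + j)} := by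
  simp only [← Nat.count_eq_card_filter_range]
  induction T with
  | zero => simp
  | succ T ih => rw [Nat.succ_mul, Nat.count_add, ih, sum_range_succ]

theorem sum_digitGain_dp (d : ℕ → ℕ → ℕ) :
    ∑ i ∈ range I.T, (I.dp off).digitGain i (d (i + 1)) =
      {e ∈ I.G.temporalEdges | ∃ v ∈ e.1, d (e.2 + 1) v % (I.dp off).L ≠ 0}.ncard := by
  rw [ncard_temporalEdges (off := off) fun i v => d (i + 1) v % (I.dp off).L ≠ 0, Nat.mul_assoc,
    card_filter_range_mul]
  refine sum_congr rfl fun i _ => ?_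
  rw [digitGain]
  change #{j ∈ range (I.n * I.n) | _} = _
  congr 1
  refine filter_congr fun j hj => ?_
  rw [mem_range] at hj
  have hn : 0 < I.n := Nat.pos_of_ne_zero fun e => by simp [e] at hj
  have e₁ : (i * (I.n * I.n) + j) / (I.n * I.n) = i := by
    rw [Nat.add_comm, Nat.add_mul_div_right _ _ (Nat.mul_pos hn hn), Nat.div_eq_of_lt hj,
      Nat.zero_add]
  have e₂ : (i * (I.n * I.n) + j) / I.n = i * I.n + j / I.n := by
    rw [← Nat.mul_assoc, Nat.add_comm, Nat.add_mul_div_right _ _ hn, Nat.add_comm]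
  have e₃ : (i * I.n + j / I.n) % I.n = j / I.n := by
    rw [Nat.add_comm, Nat.add_mul_mod_self_right, Nat.mod_eq_of_lt (Nat.div_lt_of_lt_mul hj)]
  have e₄ : (i * (I.n * I.n) + j) % I.n = j % I.n := by
    rw [← Nat.mul_assoc, Nat.add_comm, Nat.add_mul_mod_self_right]
  rw [e₁, e₂, e₃, e₄]
  refine and_congr Iff.rfl (and_congr Iff.rfl ?_)
  change 1 ≤ d (i + 1) (j / I.n) % (I.dp off).L + d (i + 1) (j % I.n) % (I.dp off).L ↔ _
  omega

theorem edgeCount_dp : (I.dp off).edgeCount = I.G.temporalEdges.ncard := by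
  have h := ncard_temporalEdges (I := I) (off := off) fun _ _ => True
  have h' : {e ∈ I.G.temporalEdges | ∃ v ∈ e.1, True} = I.G.temporalEdges := by
    ext ⟨e, i⟩
    induction e with | _ u v
    simp
  rw [h'] at h
  rw [h]
  simp only [or_self, and_true]
  rfl

end TVCInstance

/-! ## Sequences of digits and timelines -/

namespace TimelineDP

variable {D : TimelineDP}

theorem L_pos : 0 < D.L := Nat.succ_pos _

/-- A vertex that has left the bags never returns, so forgetting its digit loses no information that
is needed later. -/
theorem Bag.between {p m q v : ℕ} (hp : D.Bag p v) (hq : D.Bag q v) (hpm : p ≤ m) (hmq : m ≤ q) :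
    D.Bag m v := by
  obtain ⟨⟨j, hj, hinc, hjp⟩, -⟩ := hp
  obtain ⟨-, j', hj', hinc', hjq⟩ := hq
  exact ⟨⟨j, hj, hinc, hjp.trans hpm⟩, j', hj', hinc', hmq.trans hjq⟩

theorem Run.bag {d : ℕ → ℕ → ℕ} (hd : D.Run d) {q v : ℕ} (h : d q v % D.L ≠ 0) : D.Bag q v := by
  by_contra hb
  have h₁ := hd.lt q v
  rw [base, if_neg hb, Nat.lt_one_iff] at h₁
  exact h (by rw [h₁, Nat.zero_mod])

/-- The number of the activity interval to which the digit of an active vertex belongs. -/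
theorem Run.div_lt {d : ℕ → ℕ → ℕ} (hd : D.Run d) {q v : ℕ} (h : d q v % D.L ≠ 0) :
    d q v / D.L < D.k := by
  have h₁ : d q v < D.k * D.L + 1 := (hd.lt q v).trans_le (base_le_S q v)
  -- The largest digit `k * L` is divisible by `L`, so an active digit lies strictly below it.
  refine Nat.div_lt_of_lt_mul (lt_of_le_of_ne (by rw [Nat.mul_comm]; omega) fun e => h ?_)
  rw [e, Nat.mul_mod_right]

/-- While a vertex uses the same activity interval, its digit grows in every time step. -/
theorem Run.growth {d : ℕ → ℕ → ℕ} (hd : D.Run d) {v a b : ℕ} (hv : v < D.n) (hab : a ≤ b)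
    (hb : b < D.T) (ha : d (a + 1) v % D.L ≠ 0) (hb' : d (b + 1) v % D.L ≠ 0)
    (h : d (a + 1) v / D.L = d (b + 1) v / D.L) : b - a ≤ D.ℓ := by
  have hL := D.L_pos
  -- Either the digit has gained at least one per step, or it has left the block of `d (a + 1) v`.
  -- The second alternative persists because digits do not decrease, and it fails at `b`, where the
  -- quotient is the same as at `a`.
  have key : ∀ m, a + m ≤ b → d (a + 1) v + m ≤ d (a + m + 1) v ∨
      (d (a + 1) v / D.L + 1) * D.L ≤ d (a + m + 1) v := by
    intro m
    induction m with
    | zero => exact fun _ => Or.inl le_rfl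
    | succ m ih =>
      intro hm
      have h₁ := hd.succ_le (a + m + 1) (by omega) v hv
      -- The vertex cannot leave the bag between two active times, so its digit is never reset.
      have hb₁ : D.Bag (a + m + 1 + 1) v :=
        (hd.bag ha).between (hd.bag hb') (by omega) (by omega)
      rw [if_pos hb₁] at h₁
      change d (a + 1) v + (m + 1) ≤ d (a + m + 1 + 1) v ∨ _ ≤ d (a + m + 1 + 1) v
      rcases ih (by omega) with h₂ | h₂
      · by_cases h₃ : d (a + m + 1) v % D.L = 0
        · right
          rw [succDigit, if_neg (by omega)] at h₁
          refine le_trans ?_ h₁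
          obtain ⟨c, hc⟩ := Nat.dvd_of_mod_eq_zero h₃
          rw [hc, Nat.mul_comm D.L]
          refine Nat.mul_le_mul_right _ (Nat.succ_le_of_lt (Nat.div_lt_of_lt_mul ?_))
          refine lt_of_le_of_ne (by omega) fun e => ha ?_
          rw [e, Nat.mul_mod_right]
        · left
          rw [succDigit, if_pos (by omega)] at h₁
          omega
      · right
        refine h₂.trans (le_trans ?_ h₁)
        rw [succDigit]; split_ifs <;> omega
  have e₁ := Nat.div_add_mod' (d (a + 1) v) D.L
  have e₂ := Nat.div_add_mod' (d (b + 1) v) D.L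
  have l₂ := Nat.mod_lt (d (b + 1) v) hL
  -- Both residues lie between `1` and `ℓ + 1`, so the growth inside one block is at most `ℓ`.
  have hLℓ : D.L = D.ℓ + 2 := rfl
  have h₂ := key (b - a) (by omega)
  rw [Nat.add_sub_cancel' hab] at h₂
  rw [← h] at e₂
  rw [Nat.add_mul] at h₂
  omega

end TimelineDP

/-! ### Translating runs into timelines and back. -/

namespace TVCInstance

variable {I : TVCInstance} {off : ℕ}

/-- The time steps at which the vertex `v` uses its activity interval `u`. -/
def activeTimes (d : ℕ → ℕ → ℕ) (L T v u : ℕ) : Set (Fin T) :=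
  {i | d (i + 1) v % L ≠ 0 ∧ d (i + 1) v / L = u}

/-- Interval `u` of a vertex is the hull of its active times with quotient `u`; `Run.growth` bounds
its length. The quotient at the left end determines the interval, so a vertex has at most `k` of
them. -/
theorem exists_timeline_of_run {d : ℕ → ℕ → ℕ} (hd : (I.dp off).Run d) :
    ∃ S : Set (Fin I.n × Fin I.T × Fin I.T), IsTimeline I.k I.ℓ S ∧
      ∀ (i : Fin I.T) (v : Fin I.n), d (i + 1) v % (I.dp off).L ≠ 0 → IsActive S v i := by
  set A : Fin I.n → ℕ → Set (Fin I.T) := fun v u => activeTimes d (I.dp off).L I.T v u with hA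
  refine ⟨{x | ∃ u < (I.dp off).k, IsLeast (A x.1 u) x.2.1 ∧ IsGreatest (A x.1 u) x.2.2},
    ⟨?_, fun v => ?_⟩, fun i v h => ?_⟩
  · rintro ⟨v, a, b⟩ ⟨u, -, ha, hb⟩
    have hab : a ≤ b := ha.2 hb.1
    refine ⟨hab, ?_⟩
    have h := hd.growth v.2 (Fin.le_def.1 hab) b.2 ha.1.1 hb.1.1 (ha.1.2.trans hb.1.2.symm)
    exact h.trans (min_le_left _ _)
  · refine le_trans ?_ (min_le_left I.k I.T)
    rw [← card_range (min I.k I.T), ← Set.ncard_coe_finset]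
    refine Set.ncard_le_ncard_of_injOn (fun x => d (x.2.1 + 1) v / (I.dp off).L) ?_ ?_
      (Finset.finite_toSet _)
    · rintro ⟨w, a, b⟩ ⟨⟨u, hu, ha, -⟩, hw⟩
      obtain rfl : w = v := hw
      simp only [coe_range, Set.mem_Iio]
      rw [ha.1.2]
      exact hu
    · rintro ⟨w, a, b⟩ ⟨⟨u, hu, ha, hb⟩, hw⟩ ⟨w', a', b'⟩ ⟨⟨u', hu', ha', hb'⟩, hw'⟩ h
      obtain rfl : w = v := hw
      obtain rfl : w' = w := hw'
      dsimp only at h ha ha' hb hb'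
      rw [ha.1.2, ha'.1.2] at h
      subst h
      rw [ha.unique ha', hb.unique hb']
  · have hi : i ∈ A v (d (i + 1) v / (I.dp off).L) := ⟨h, rfl⟩
    have hfin : (A v (d (i + 1) v / (I.dp off).L)).Finite := Set.toFinite _
    obtain ⟨a, ha, ha'⟩ := Set.exists_min_image _ id hfin ⟨i, hi⟩
    obtain ⟨b, hb, hb'⟩ := Set.exists_max_image _ id hfin ⟨i, hi⟩
    exact ⟨a, b, ⟨_, hd.div_lt h, ⟨ha, ha'⟩, ⟨hb, hb'⟩⟩, ha' i hi, hb' i hi⟩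

/-- An activity interval of `v` starts at time `q`. -/
def Starts (S : Set (Fin I.n × Fin I.T × Fin I.T)) (v q : ℕ) : Prop :=
  ∃ x ∈ S, (x.1 : ℕ) = v ∧ (x.2.1 : ℕ) = q

open Classical in
/-- The digits of the vertex `v` for a timeline. -/
noncomputable def digits (I : TVCInstance) (off : ℕ) (S : Set (Fin I.n × Fin I.T × Fin I.T))
    (v : ℕ) : ℕ → ℕ
  | 0 => 0
  | q + 1 =>
    if Starts S v q then (digits I off S v q + (I.dp off).L - 1) / (I.dp off).L * (I.dp off).L + 1
    else (I.dp off).succDigit (digits I off S v q)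

theorem le_ceil_mul (e L : ℕ) (hL : 0 < L) : e ≤ (e + L - 1) / L * L := by
  have h₁ := Nat.div_add_mod' (e + L - 1) L
  have h₂ := Nat.mod_lt (e + L - 1) hL
  omega

variable {S : Set (Fin I.n × Fin I.T × Fin I.T)}

/-- Rounding up to a multiple of `L` and adding one, as happens at a start, yields at least the old
digit plus one. -/
theorem succDigit_digits_le (v q : ℕ) :
    (I.dp off).succDigit (digits I off S v q) ≤ digits I off S v (q + 1) := by
  rw [digits]
  split_ifs
  · have := le_ceil_mul (digits I off S v q) _ (I.dp off).L_pos
    rw [succDigit]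
    split_ifs <;> omega
  · exact le_rfl

-- Each start opens at most one new block of `L` digits. Without a start only an active digit grows,
-- and such a digit is not a multiple of `L`, hence strictly below the bound.
open Classical in
theorem digits_le (v q : ℕ) : digits I off S v q ≤ Nat.count (Starts S v) q * (I.dp off).L := by
  have hL := (I.dp off).L_pos
  induction q with
  | zero => simp [digits]
  | succ q ih =>
    rw [digits, Nat.count_succ]
    split_ifs with h
    · rw [Nat.succ_mul]
      refine Nat.add_le_add (Nat.mul_le_mul_right _ ?_) hL
      refine Nat.le_of_lt_succ (Nat.div_lt_of_lt_mul ?_)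
      rw [Nat.mul_comm, Nat.succ_mul]
      omega
    · rw [succDigit, Nat.add_zero]
      split_ifs with h₁
      · refine Nat.succ_le_of_lt (lt_of_le_of_ne ih fun e => ?_)
        rw [e, Nat.mul_mod_left] at h₁
        omega
      · exact ih

-- Intervals with a common start are counted once, so `T` is a bound as well as `k`. This is why
-- capping `k` at `T` is harmless.
open Classical in
theorem count_starts_le (hS : IsTimeline I.k I.ℓ S) {v : ℕ} (hv : v < I.n) {q : ℕ} (hq : q ≤ I.T) :
    Nat.count (Starts S v) q ≤ min I.k I.T := by
  refine le_min ?_ ((Nat.count_le _).trans hq)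
  refine le_trans ?_ (hS.2 ⟨v, hv⟩)
  rw [Nat.count_eq_card_filter_range, ← Set.ncard_coe_finset]
  refine le_trans (Set.ncard_le_ncard (t := (fun x : Fin I.n × Fin I.T × Fin I.T => (x.2.1 : ℕ)) ''
    {x ∈ S | x.1 = ⟨v, hv⟩}) (fun m hm => ?_) (Set.toFinite _)) (Set.ncard_image_le (Set.toFinite _))
  obtain ⟨x, hx, hxv, hxm⟩ := (mem_filter.1 (mem_coe.1 hm)).2
  exact ⟨x, ⟨hx, Fin.ext hxv⟩, hxm⟩

/-- The residue is `1` at the start of the interval. Afterwards it grows by one in each step, unless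
another start resets it to `1`, so for `m ≤ ℓ` it stays below `L` and cannot wrap around. -/
theorem digits_mod_ne_zero {v : Fin I.n} {a b : Fin I.T} (h : (v, a, b) ∈ S) (m : ℕ)
    (hm : m ≤ (I.dp off).ℓ) : digits I off S v (a + m + 1) % (I.dp off).L ≠ 0 ∧
      digits I off S v (a + m + 1) % (I.dp off).L ≤ m + 1 := by
  have hL : (I.dp off).L = (I.dp off).ℓ + 2 := rfl
  have hone : 1 % (I.dp off).L = 1 := Nat.mod_eq_of_lt (by omega)
  have hst : ∀ c : ℕ, (c * (I.dp off).L + 1) % (I.dp off).L = 1 := fun c => by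
    rw [Nat.mul_add_mod_self_right, hone]
  induction m with
  | zero =>
    rw [digits, if_pos ⟨_, h, rfl, rfl⟩, hst]
    omega
  | succ m ih =>
    obtain ⟨h₁, h₂⟩ := ih (by omega)
    rw [← Nat.add_assoc, digits]
    split_ifs
    · rw [hst]; omega
    · rw [succDigit, if_pos (by omega), Nat.add_mod, hone, Nat.mod_eq_of_lt (by omega)]
      omega

/-- Digits outside the bags are erased. No coverage is lost, since both endpoints of an edge are in
the bag of its time. Transitions remain valid, since an erased digit `0` has the minimal successor
`0`. -/
theorem exists_run_of_timeline (hS : IsTimeline I.k I.ℓ S) : ∃ d, (I.dp off).Run d ∧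
    ∀ (i : Fin I.T) (u v : Fin I.n), (I.G i).Adj u v → IsActive S u i →
      d (i + 1) u % (I.dp off).L ≠ 0 := by
  classical
  refine ⟨fun q v => if (I.dp off).Bag q v ∧ v < I.n ∧ q ≤ I.T then digits I off S v q else 0,
    ⟨fun q v => ?_, fun i hi v hv => ?_⟩, fun i u v hadj hact => ?_⟩
  · split_ifs with h
    · rw [base, if_pos h.1]
      refine Nat.lt_succ_of_le ((digits_le v q).trans (Nat.mul_le_mul_right _ ?_))
      exact count_starts_le hS h.2.1 h.2.2
    · exact (I.dp off).one_le_base q v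
  · have h0 : (I.dp off).succDigit 0 = 0 := if_neg (by rw [Nat.zero_mod]; omega)
    change i < I.T at hi
    change v < I.n at hv
    by_cases hb : (I.dp off).Bag (i + 1) v
    · have e : (if (I.dp off).Bag (i + 1) v ∧ v < I.n ∧ i + 1 ≤ I.T
          then digits I off S v (i + 1) else 0) = digits I off S v (i + 1) := if_pos ⟨hb, hv, hi⟩
      rw [if_pos hb, e]
      split_ifs
      · exact succDigit_digits_le v i
      · rw [h0]; exact Nat.zero_le _
    · rw [if_neg hb, h0]; exact Nat.zero_le _
  · dsimp only
    rw [if_pos ⟨I.bag_dp_of_adj hadj, u.2, i.2⟩]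
    obtain ⟨a, b, hx, hai, hib⟩ := hact
    have hlen := (hS.1 _ hx).2
    have h₁ : (a : ℕ) ≤ i := hai
    have h₂ : (i : ℕ) ≤ b := hib
    have h₃ := b.2
    dsimp only at hlen
    -- The offset `i - a` is at most `ℓ` and at most `T`, so the capped length suffices.
    have h := (digits_mod_ne_zero (off := off) hx (i - a) (le_min (by omega) (by omega))).1
    rwa [Nat.add_sub_cancel' h₁] at h

theorem accepts_dp_iff (t : ℕ) : (I.dp off).Accepts t ↔
    ∃ S : Set (Fin I.n × Fin I.T × Fin I.T), IsTimeline I.k I.ℓ S ∧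
      t ≤ {e ∈ I.G.temporalEdges | IsCovered S e}.ncard := by
  classical
  rw [Accepts]
  split_ifs with h
  · change I.T * I.n * I.n = 0 at h
    have hE : ∀ S : Set (Fin I.n × Fin I.T × Fin I.T),
        {e ∈ I.G.temporalEdges | IsCovered S e} = ∅ := fun S => by
      refine Set.eq_empty_of_forall_notMem fun e he => ?_
      obtain ⟨-, v, -, -⟩ := he
      exact absurd h (Nat.mul_ne_zero (Nat.mul_ne_zero e.2.pos.ne' v.pos.ne') v.pos.ne')
    constructor
    · rintro rfl
      exact ⟨∅, ⟨fun x hx => hx.elim, fun v => by simp⟩, Nat.zero_le _⟩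
    · rintro ⟨S, -, ht⟩
      rw [hE, Set.ncard_empty] at ht
      omega
  · rw [exists_marks_iff, exists_reach_iff]
    have hsum := I.sum_digitGain_dp (off := off)
    constructor
    · rintro ⟨d, hd, ht⟩
      obtain ⟨S, hS, hact⟩ := exists_timeline_of_run hd
      refine ⟨S, hS, ht.trans ((hsum d).trans_le (Set.ncard_le_ncard ?_ (Set.toFinite _)))⟩
      rintro e ⟨he, v, hv, hne⟩
      exact ⟨he, v, hv, hact _ _ hne⟩
    · rintro ⟨S, hS, ht⟩
      obtain ⟨d, hd, hact⟩ := exists_run_of_timeline (off := off) hS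
      refine ⟨d, hd, ht.trans (le_trans (Set.ncard_le_ncard ?_ (Set.toFinite _)) (hsum d).ge)⟩
      rintro ⟨e, i⟩ ⟨he, v, hv, hS'⟩
      refine ⟨he, v, hv, ?_⟩
      obtain ⟨u, rfl⟩ := Sym2.mem_iff_exists.1 hv
      exact hact i v u he hS'

/-- The edge set is finite, so as many covered edges as edges means that all are covered. -/
theorem timelineVC_iff : TimelineVC I ↔ (I.dp off).Accepts (I.dp off).edgeCount := by
  rw [accepts_dp_iff, edgeCount_dp, TimelineVC]
  refine exists_congr fun S => and_congr Iff.rfl ⟨fun h => ?_, fun h e he => ?_⟩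
  · exact Set.ncard_le_ncard (fun e he => ⟨he, h e he⟩) (Set.toFinite _)
  · have h₁ := Set.eq_of_subset_of_ncard_le (Set.sep_subset I.G.temporalEdges (IsCovered S)) h
      (Set.toFinite _)
    rw [← h₁] at he
    exact he.2

end TVCInstance

theorem TPVCInstance.timelinePVC_iff {I : TPVCInstance} {off : ℕ} :
    TimelinePVC I ↔ (I.dp off).Accepts I.t :=
  (TVCInstance.accepts_dp_iff _).symm

/-! ## The running time -/

open WordRAM

namespace TimelineDP

variable {D : TimelineDP}

/-- This is what keeps the words logarithmic. With `X = n + T + 2`, the products are at most `X ^ 7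
* P ^ 2`, and the spare factor `X ^ 3 ≥ 64` in the running time absorbs the number of summands. -/
theorem room_le_time (hoff : D.off ≤ 5) (h : D.T * D.n * D.n ≠ 0) (hS : D.S ≤ (D.n + D.T + 2) ^ 2)
    (hL : D.L ≤ D.n + D.T + 2) : D.room ≤ D.time := by
  have hT : 1 ≤ D.T := Nat.pos_of_ne_zero fun e => h (by simp [e])
  have hn : 1 ≤ D.n := Nat.pos_of_ne_zero fun e => h (by simp [e])
  have hP : 1 ≤ D.P := le_sup_right
  rw [time, if_neg h]
  set X := D.n + D.T + 2 with hX
  have hA : D.T * D.n * D.n + 1 ≤ X ^ 3 := by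
    have h₁ : D.T * D.n * D.n ≤ (X - 1) * (X - 1) * (X - 1) := by gcongr <;> omega
    have h₂ : ((X - 1) + 1) ^ 3 = X ^ 3 := by congr 1
    nlinarith
  have hE : D.E ≤ X ^ 3 := hA
  have hN : D.N ≤ X ^ 3 * D.P := Nat.mul_le_mul_right _ hE
  have hX1 : 1 ≤ X := by omega
  have hX3 : 64 ≤ X ^ 3 := by
    calc 64 = 4 ^ 3 := by norm_num
      _ ≤ X ^ 3 := Nat.pow_le_pow_left (by omega) 3
  have hmono : ∀ m ≤ 7, X ^ m ≤ X ^ 7 * D.P ^ 2 := fun m hm =>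
    (Nat.pow_le_pow_right hX1 hm).trans (Nat.le_mul_of_pos_right _ (Nat.pow_pos hP))
  have hTX : D.T + 1 ≤ X := by omega
  have h₁ : (D.T + 1) * D.N ≤ X ^ 7 * D.P ^ 2 := by
    calc (D.T + 1) * D.N ≤ X * (X ^ 3 * D.P) := Nat.mul_le_mul hTX hN
      _ = X ^ 4 * D.P ^ 1 := by ring
      _ ≤ X ^ 7 * D.P ^ 2 := Nat.mul_le_mul (Nat.pow_le_pow_right hX1 (by norm_num))
        (Nat.pow_le_pow_right hP (by norm_num))
  have h₂ : D.T * D.N * D.N ≤ X ^ 7 * D.P ^ 2 := by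
    calc D.T * D.N * D.N ≤ X * (X ^ 3 * D.P) * (X ^ 3 * D.P) :=
        Nat.mul_le_mul (Nat.mul_le_mul (by omega) hN) hN
      _ = X ^ 7 * D.P ^ 2 := by ring
  have h₃ : 64 * (X ^ 7 * D.P ^ 2) ≤ D.P ^ 2 * X ^ 10 := by
    calc 64 * (X ^ 7 * D.P ^ 2) ≤ X ^ 3 * (X ^ 7 * D.P ^ 2) := Nat.mul_le_mul_right _ hX3
      _ = D.P ^ 2 * X ^ 10 := by ring
  have m₀ := hmono 0 (by norm_num)
  have m₁ := hmono 1 (by norm_num)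
  have m₂ := hmono 2 (by norm_num)
  have m₃ := hmono 3 (by norm_num)
  rw [pow_zero] at m₀
  rw [pow_one] at m₁
  rw [room]
  omega

/-- The registers of the variables. -/
def idx : Var → ℕ := Var.ctorIdx

theorem idx_injective : idx.Injective := by
  intro x y h
  revert h
  cases x <;> cases y <;> simp [idx, Var.ctorIdx]

end TimelineDP

/-- A problem is solvable in time `τ` if its instances translate into dynamic programs whose
running time is bounded by `τ`. -/
theorem WordRAM.SolvableInTime.of_dp {α : Type*} {enc : α → List ℕ} {p : α → Prop} {τ : α → ℕ}
    {off : ℕ} {t : Expr TimelineDP.Var} (D : α → TimelineDP) (t₀ : α → ℕ) (hoff : off ≤ 5)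
    (hDoff : ∀ x, (D x).off = off)
    (hlen : ∀ x, (enc x).length = off + (D x).T * (D x).n * (D x).n)
    (hD : ∀ x, (D x).Input ((enc x).getD · 0)) (hp : ∀ x, p x ↔ (D x).Accepts (t₀ x))
    (hS : ∀ x, (D x).S ≤ ((D x).n + (D x).T + 2) ^ 2) (hL : ∀ x, (D x).L ≤ (D x).n + (D x).T + 2)
    (ht : ∀ (x : α) (σ : State TimelineDP.Var) (W : ℕ), 5 ≤ W → σ.mem = ((enc x).getD · 0) →
      σ.reg .tot = (D x).edgeCount → t.Ok W σ ∧ t.eval σ = t₀ x)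
    (hτ : ∀ x, (D x).time ≤ τ x) : SolvableInTime enc p τ := by
  classical
  refine ⟨(TimelineDP.program off t).compile TimelineDP.idx, t.cost + 1000, fun x => ?_⟩
  set M := τ x + (enc x).length + (enc x).foldr max 0 + 2 with hM
  set W := M ^ (t.cost + 1000) with hW
  have hτ1 : 1 ≤ τ x := by
    refine le_trans ?_ (hτ x)
    rw [TimelineDP.time]
    split_ifs
    · exact le_rfl
    · exact Nat.mul_pos (Nat.pow_pos (le_sup_right : 1 ≤ (D x).P)) (Nat.pow_pos (by omega))
  -- As `M ≥ 2`, already the fifth power of `M` exceeds `16 * M`; this leaves room for the additive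
  -- constants.
  have hMW : 16 * M ≤ W := by
    calc 16 * M ≤ 2 ^ 4 * M := by norm_num
      _ ≤ M ^ 4 * M := Nat.mul_le_mul_right _ (Nat.pow_le_pow_left (by omega) 4)
      _ = M ^ 5 := by ring
      _ ≤ W := Nat.pow_le_pow_right (by omega) (by omega)
  let σ : State TimelineDP.Var := ⟨fun _ => 0, fun a => (enc x).getD a 0⟩
  have hmax : ∀ a, (enc x).getD a 0 ≤ W := by
    intro a
    refine le_trans ?_ (show (enc x).foldr max 0 ≤ W by omega)
    rw [List.getD_eq_getElem?_getD]
    rcases lt_or_ge a (enc x).length with h | h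
    · rw [List.getElem?_eq_getElem h, Option.getD_some]
      exact List.le_max_of_le' 0 (List.getElem_mem h) le_rfl
    · simp [List.getElem?_eq_none h]
  have hspec := TimelineDP.spec_program (W := W) (σ := σ) (D := D x) (t := t) (t₀ := t₀ x) (hD x)
    rfl (by have := hlen x; rw [hDoff x]; omega) (fun h => ?_)
    fun ν hν hc => ht x ν W (by omega) hν hc
  · rw [hDoff x] at hspec
    obtain ⟨m, s, hexec, hm, hs, -⟩ := Cmd.exec_compile TimelineDP.idx_injective
      (show 1 ≤ W by omega) _ σ (initStore (enc x)) ⟨fun _ => Nat.zero_le _, hmax⟩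
      ⟨fun _ => rfl, rfl⟩ hspec.1
    refine ⟨m, s, hexec, hm.trans (((D x).cost_program_le off t).trans
      (Nat.mul_le_mul_left _ (hτ x))), ?_⟩
    -- The variable `.ans` is the first constructor of `Var`, so it lives in register `0`, where the
    -- answer is expected.
    have h := (hs.1 .ans).trans hspec.2
    exact h.trans (if_congr (hp x).symm rfl rfl)
  · have := TimelineDP.room_le_time (by rw [hDoff x]; exact hoff) h (hS x) (hL x)
    have := hτ x
    omega

/-! ### The running time in terms of the parameters and the input length. -/

namespace TVCInstance

variable (I : TVCInstance) (off : ℕ)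

theorem L_dp_le : (I.dp off).L ≤ (I.dp off).n + (I.dp off).T + 2 := by
  change min I.ℓ I.T + 2 ≤ I.n + I.T + 2
  omega

/-- Thanks to the caps at `T`, this bound does not depend on `k` and `ℓ`, as the XP statement
requires. -/
theorem S_dp_le : (I.dp off).S ≤ ((I.dp off).n + (I.dp off).T + 2) ^ 2 := by
  change min I.k I.T * (min I.ℓ I.T + 2) + 1 ≤ (I.n + I.T + 2) ^ 2
  have h : min I.k I.T * (min I.ℓ I.T + 2) ≤ (I.n + I.T) * (I.n + I.T + 2) :=
    Nat.mul_le_mul (by omega) (by omega)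
  nlinarith

theorem S_dp_le_mul : (I.dp off).S ≤ (I.k + 1) * (I.ℓ + 2) := by
  change min I.k I.T * (min I.ℓ I.T + 2) + 1 ≤ (I.k + 1) * (I.ℓ + 2)
  have h : min I.k I.T * (min I.ℓ I.T + 2) ≤ I.k * (I.ℓ + 2) :=
    Nat.mul_le_mul (by omega) (by omega)
  nlinarith

theorem time_dp_le {B : ℕ} (hB : (I.dp off).S ≤ B) :
    (I.dp off).time ≤ B ^ (2 * I.G.vimw) * (I.n + I.T + 2) ^ 10 := by
  have h1 : 1 ≤ B := (I.dp off).one_le_S.trans hB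
  rw [TimelineDP.time]
  split_ifs
  · exact Nat.mul_pos (Nat.pow_pos h1) (Nat.pow_pos (by omega))
  · refine Nat.mul_le_mul ?_ le_rfl
    rw [Nat.mul_comm 2, Nat.pow_mul]
    exact Nat.pow_le_pow_left ((I.P_dp_le (off := off)).trans (Nat.pow_le_pow_left hB _)) 2

/-- If there is anything to do, the numbers of vertices and time steps are bounded by the length of
the input. -/
theorem add_le_of_length {N : ℕ} (h : I.T * I.n * I.n ≠ 0) (hN : 4 + I.T * I.n * I.n ≤ N) :
    I.n + I.T + 2 ≤ N := by
  have hT : 1 ≤ I.T := Nat.pos_of_ne_zero fun e => h (by simp [e])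
  have hn : 1 ≤ I.n := Nat.pos_of_ne_zero fun e => h (by simp [e])
  have h₁ : I.T * I.n ≤ I.T * I.n * I.n := Nat.le_mul_of_pos_right _ hn
  nlinarith

/-- If `T * n * n = 0`, then `n + T` need not be bounded by the length, but the running time is
constant. Otherwise the matrices alone make the input long enough. -/
theorem time_dp_le_of_length {B N : ℕ} (hN : 4 + I.T * I.n * I.n ≤ N)
    (hB : I.T * I.n * I.n ≠ 0 → (I.dp off).S ≤ B) (h1 : 1 ≤ B) :
    (I.dp off).time ≤ B ^ (2 * I.G.vimw) * N ^ 10 := by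
  by_cases h : I.T * I.n * I.n = 0
  · rw [TimelineDP.time, if_pos (show (I.dp off).T * (I.dp off).n * (I.dp off).n = 0 from h)]
    exact Nat.mul_pos (Nat.pow_pos h1) (Nat.pow_pos (by omega))
  · exact (I.time_dp_le off (hB h)).trans
      (Nat.mul_le_mul_left _ (Nat.pow_le_pow_left (I.add_le_of_length h hN) _))

theorem input_dp {μ : ℕ → ℕ} (h0 : μ 0 = I.n) (h1 : μ 1 = I.T) (h2 : μ 2 = I.k) (h3 : μ 3 = I.ℓ)
    (ha : ∀ j, μ (off + j) = I.G.encode.getD j 0) : (I.dp off).Input μ where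
  n := h0
  T := h1
  k := by rw [h2]; rfl
  ℓ := by rw [h3]; rfl
  a := ha
  a_eq_zero j hj := by
    change I.G.encode.getD j 0 = 0
    rw [List.getD_eq_getElem?_getD, List.getElem?_eq_none (by rw [I.G.length_encode]; exact hj)]
    rfl

end TVCInstance

theorem WordRAM.length_le_inputLength (l : List ℕ) : l.length ≤ inputLength l := by
  rw [inputLength]
  induction l with
  | nil => simp
  | cons a l ih =>
    simp only [List.length_cons, List.map_cons, List.sum_cons]
    omega

theorem timelinePVC_solvable {τ : TPVCInstance → ℕ} (hτ : ∀ I, (I.dp 5).time ≤ τ I) :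
    SolvableInTime TPVCInstance.encode TimelinePVC τ :=
  .of_dp (t := .mem 4) (fun I => I.dp 5) (fun I => I.t) le_rfl (fun _ => rfl)
    (fun I => by
      rw [TPVCInstance.encode, List.length_append, I.G.length_encode]
      rfl)
    (fun I => I.input_dp 5 rfl rfl rfl rfl fun j => by
      simp [TPVCInstance.encode, Nat.add_comm 5 j])
    (fun _ => TPVCInstance.timelinePVC_iff) (fun I => I.S_dp_le 5) (fun I => I.L_dp_le 5)
    (fun I σ W hW hσ _ => by
      simp only [Expr.ok_mem, Expr.ok_ofNat, Expr.eval_mem, Expr.eval_ofNat, hσ]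
      exact ⟨by omega, rfl⟩) hτ

theorem timelineVC_solvable {τ : TVCInstance → ℕ} (hτ : ∀ I, (I.dp 4).time ≤ τ I) :
    SolvableInTime TVCInstance.encode TimelineVC τ :=
  .of_dp (t := .var .tot) (fun I => I.dp 4) (fun I => (I.dp 4).edgeCount)
    (Nat.le_succ 4)
    (fun _ => rfl)
    (fun I => by
      rw [TVCInstance.encode, List.length_append, I.G.length_encode]
      rfl)
    (fun I => I.input_dp 4 rfl rfl rfl rfl fun j => by
      simp [TVCInstance.encode, Nat.add_comm 4 j])
    (fun _ => TVCInstance.timelineVC_iff) (fun I => I.S_dp_le 4) (fun I => I.L_dp_le 4)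
    (fun I σ W _ _ hc => ⟨trivial, hc⟩) hτ

theorem TPVCInstance.length_le (I : TPVCInstance) :
    4 + I.T * I.n * I.n ≤ inputLength I.encode := by
  refine le_trans ?_ (length_le_inputLength _)
  rw [encode, List.length_append, I.G.length_encode]
  exact Nat.add_le_add_right (by simp) _

theorem TVCInstance.length_le (I : TVCInstance) :
    4 + I.T * I.n * I.n ≤ inputLength I.encode := by
  refine le_trans ?_ (length_le_inputLength _)
  rw [encode, List.length_append, I.G.length_encode]
  exact Nat.add_le_add_right (by simp) _

theorem computable_fpt_bound :
    Computable fun x : ℕ => ((x + 1) * (x + 2)) ^ (2 * x) := by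
  refine Primrec.to_comp ?_
  exact (Primrec₂.unpaired'.1 Nat.Primrec.pow).comp
    (Primrec.nat_mul.comp (Primrec.nat_add.comp .id (.const 1))
      (Primrec.nat_add.comp .id (.const 2))) (Primrec.nat_mul.comp (.const 2) .id)

theorem computable_xp_exponent : Computable fun x : ℕ => 4 * x + 10 :=
  (Primrec.nat_add.comp (Primrec.nat_mul.comp (.const 4) .id) (.const 10)).to_comp

namespace TVCInstance

variable (I : TVCInstance) (off : ℕ)

theorem time_dp_le_fpt {N : ℕ} (hN : 4 + I.T * I.n * I.n ≤ N) : (I.dp off).time ≤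
    ((I.G.vimw + I.k + I.ℓ + 1) * (I.G.vimw + I.k + I.ℓ + 2)) ^ (2 * (I.G.vimw + I.k + I.ℓ)) *
      N ^ 10 := by
  have hB : (I.dp off).S ≤ (I.G.vimw + I.k + I.ℓ + 1) * (I.G.vimw + I.k + I.ℓ + 2) :=
    (I.S_dp_le_mul off).trans (Nat.mul_le_mul (by omega) (by omega))
  have h1 := (I.dp off).one_le_S.trans hB
  exact (I.time_dp_le_of_length off hN (fun _ => hB) h1).trans
    (Nat.mul_le_mul_right _ (Nat.pow_le_pow_right h1 (by omega)))

/-- With `S ≤ N ^ 2` the factor `S ^ (2 * vimw)` turns into `N ^ (4 * vimw)`, which yields the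
exponent and allows `f = 1`. -/
theorem time_dp_le_xp {N : ℕ} (hN : 4 + I.T * I.n * I.n ≤ N) :
    (I.dp off).time ≤ 1 * N ^ (4 * I.G.vimw + 10) := by
  have h1 : 1 ≤ N ^ 2 := Nat.pow_pos (by omega)
  refine (I.time_dp_le_of_length off hN (B := N ^ 2) (fun h => (I.S_dp_le off).trans
    (Nat.pow_le_pow_left (I.add_le_of_length h hN) 2)) h1).trans_eq ?_
  rw [one_mul, ← pow_mul, ← pow_add]
  congr 1
  ring

end TVCInstance

theorem mainTheorem1 :
    ((∃ c : ℕ, WordRAM.SolvableInTime TPVCInstance.encode TimelinePVC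
        fun I => ((I.k + 1) * (I.ℓ + 2)) ^ (2 * I.G.vimw) * (I.n + I.T + 2) ^ c) ∧
      WordRAM.IsFPT TPVCInstance.encode TimelinePVC (fun I => I.G.vimw + I.k + I.ℓ) ∧
      WordRAM.IsXP TPVCInstance.encode TimelinePVC (fun I => I.G.vimw)) ∧
    ((∃ c : ℕ, WordRAM.SolvableInTime TVCInstance.encode TimelineVC
        fun I => ((I.k + 1) * (I.ℓ + 2)) ^ (2 * I.G.vimw) * (I.n + I.T + 2) ^ c) ∧
      WordRAM.IsFPT TVCInstance.encode TimelineVC (fun I => I.G.vimw + I.k + I.ℓ) ∧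
      WordRAM.IsXP TVCInstance.encode TimelineVC (fun I => I.G.vimw)) :=
  ⟨⟨⟨10, timelinePVC_solvable fun I => I.time_dp_le 5 (I.S_dp_le_mul 5)⟩,
    ⟨_, computable_fpt_bound, 10, timelinePVC_solvable fun I => I.time_dp_le_fpt 5 I.length_le⟩,
    ⟨fun _ => 1, _, .const 1, computable_xp_exponent,
      timelinePVC_solvable fun I => I.time_dp_le_xp 5 I.length_le⟩⟩,
    ⟨10, timelineVC_solvable fun I => I.time_dp_le 4 (I.S_dp_le_mul 4)⟩,
    ⟨_, computable_fpt_bound, 10, timelineVC_solvable fun I => I.time_dp_le_fpt 4 I.length_le⟩,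
    ⟨fun _ => 1, _, .const 1, computable_xp_exponent,
      timelineVC_solvable fun I => I.time_dp_le_xp 4 I.length_le⟩⟩
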